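/- **Theorem (epi-continuity of the Bregman proximal average in $\lambda$).** *Setting.* For $g:\mathbb R^n\to[-\infty,+\infty]$ write $\operatorname{dom} g=\{x: g(x)<+\infty\}$, $g^*(y)=\sup_x(\langle y,x\rangle-g(x))$, $\operatorname{conv} g$ for the convex hull of $g$ (so $(\operatorname{conv} g)(x)=\inf\{r\in\mathbb R:(x,r)\in\operatorname{conv}(\operatorname{epi} g)\}$), $\operatorname{cl} g$ for its lower semicontinuous hull, $a\star g=a\,g(\cdot/a)$ for $a>0$ and $0\star g=\iota_{\{0\}}$, and $(g\,\square\,h)(x)=\inf_u (g(u)+h(x-u))$. Here $\iota_C$ is the indicator function of $C$ ($0$ on $C$, $+\infty$ elsewhere). The conventions are $(+\infty)+(-\infty)=(+\infty)-(+\infty)=+\infty$ and $0\cdot(+\infty)=0$. Let $\phi:\mathbb R^n\to\,]-\infty,+\infty]$ be proper, lower semicontinuous, convex and of Legendre type (essentially smooth and essentially strictly convex), with $\phi(x)/\|x\|\to+\infty$ as $\|x\|\to+\infty$. Put $U=\operatorname{int}\operatorname{dom}\phi$ (nonempty). Assume that $\operatorname{dom}\phi$ is closed, that $\phi$ is relatively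 continuous on $\operatorname{dom}\phi$, and that $\phi$ is twice continuously differentiable on $U$ with positive definite Hessian at every point of $U$. For $y\in U$ let $D_\phi(x,y)=\phi(x)-\phi(y)-\langle\nabla\phi(y),x-y\rangle$. A function $f:\mathbb R^n\to\,]-\infty,+\infty]$ is prox-bounded if there are $\lambda>0$ and $y\in U$ with $\inf_x\big(f(x)+\tfrac1\lambda D_\phi(x,y)\big)>-\infty$; the supremum of all such $\lambda$ is its threshold $\lambda_f\in\,]0,+\infty]$. Let $f_1,f_2:\mathbb R^n\to\,]-\infty,+\infty]$ be proper, lower semicontinuous and prox-bounded, with $\operatorname{dom} f_i\cap\operatorname{dom}\phi\ne\varnothing$ for $i=1,2$. Let $\bar\lambda=\min\{\lambda_{f_1},\lambda_{f_2}\}$ and $\alpha\in[0,1]$. For $0<\lambda<\bar\lambda$ let $$\mathcal P_\lambda=\Big[\alpha\big(f_1+\tfrac1\lambda\phi\big)^*+(1-\alpha)\big(f_2+\tfrac1\lambda\phi\big)^*\Big]^*-\tfrac1\lambda\phi .$$ Put $\tilde f_i=f_i+\iota_{\operatorname{dom}\phi}$. A sequence $(g_k)$ epi-converges to $g$ if for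 every $x$: (a) $g(x)\le\liminf_k g_k(x_k)$ whenever $x_k\to x$, and (b) $g_k(x_k)\to g(x)$ for some $x_k\to x$. A family $(\mathcal P_\lambda)$ epi-converges as $\lambda$ tends to a limit if $(\mathcal P_{\lambda_k})$ epi-converges along every sequence $(\lambda_k)$ in $]0,\bar\lambda[$ tending to that limit. *Conclusion.* 1. For every $x\in\mathbb R^n$, the function $\lambda\mapsto\mathcal P_\lambda(x)$ is nonincreasing on $]0,\bar\lambda[$. 2. If $\bar\lambda<+\infty$, then for every $x\in\mathbb R^n$, in $[-\infty,+\infty]$, $$\lim_{\lambda\uparrow\bar\lambda}\mathcal P_\lambda(x)=\Big(\big[\alpha\star\operatorname{conv}(f_1+\tfrac1{\bar\lambda}\phi)\big]\,\square\,\big[(1-\alpha)\star\operatorname{conv}(f_2+\tfrac1{\bar\lambda}\phi)\big]\Big)(x)-\tfrac1{\bar\lambda}\phi(x).$$ If $\bar\lambda=+\infty$, then for every $x\in\mathbb R^n$, in $[-\infty,+\infty]$, $$\lim_{\lambda\uparrow+\infty}\mathcal P_\lambda(x)=\big([\alpha\star\operatorname{conv}\tilde f_1]\,\square\,[(1-\alpha)\star\operatorname{conv}\tilde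 f_2]\big)(x),$$ and $\mathcal P_\lambda$ epi-converges to $\operatorname{cl}\big([\alpha\star\operatorname{conv}\tilde f_1]\,\square\,[(1-\alpha)\star\operatorname{conv}\tilde f_2]\big)$ as $\lambda\uparrow+\infty$. 3. For every $x\in U$, $\lim_{\lambda\downarrow0}\mathcal P_\lambda(x)=\alpha f_1(x)+(1-\alpha)f_2(x)$. If moreover $\operatorname{dom} f_i\subseteq U$ for $i=1,2$, then $\mathcal P_\lambda$ epi-converges to $\alpha f_1+(1-\alpha)f_2$ as $\lambda\downarrow0$. -/

import Mathlib

open Filter Topology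

noncomputable section

namespace BregmanAvg

/-- Euclidean space of dimension `n`. -/
abbrev Rn (n : ℕ) := EuclideanSpace ℝ (Fin n)

variable {n : ℕ}

/-! ### Extended-real-valued functions -/

/-- Effective domain: the points where the value is less than `+∞`. -/
def effDom (f : Rn n → EReal) : Set (Rn n) := {x | f x < ⊤}

/-- Interior of the effective domain. -/
def intDom (f : Rn n → EReal) : Set (Rn n) := interior (effDom f)

/-- The values as real numbers; meaningful on the effective domain of a proper function. -/
def realVal (f : Rn n → EReal) (x : Rn n) : ℝ := (f x).toReal

/-- Epigraph, as a subset of `ℝⁿ × ℝ`. -/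
def epi (f : Rn n → EReal) : Set (Rn n × ℝ) := {p | f p.1 ≤ (p.2 : EReal)}

/-- Never `-∞`, and not identically `+∞`. -/
def IsProper (f : Rn n → EReal) : Prop := (∀ x, f x ≠ ⊥) ∧ (effDom f).Nonempty

/-- Proper lower semicontinuous convex functions. -/
structure IsGammaZero (f : Rn n → EReal) : Prop where
  proper : IsProper f
  lsc : LowerSemicontinuous f
  convex : Convex ℝ (epi f)

open Classical in
/-- Sum of extended reals with the convention `(+∞) + (-∞) = +∞`. -/
def upAdd (a b : EReal) : EReal := if a = ⊤ ∨ b = ⊤ then ⊤ else a + b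

/-- Difference of extended reals with the convention `(+∞) - (+∞) = +∞`. -/
def upSub (a b : EReal) : EReal := upAdd a (-b)

open Classical in
/-- Indicator function of a set: `0` on the set, `+∞` outside. -/
def indic (C : Set (Rn n)) (x : Rn n) : EReal := if x ∈ C then 0 else ⊤

/-- Fenchel conjugate. -/
def conj (f : Rn n → EReal) (y : Rn n) : EReal :=
  ⨆ x : Rn n, ((inner ℝ y x : ℝ) : EReal) - f x

/-- Convex hull of a function: its epigraph is, up to vertical closure, the convex hull of
the epigraph. -/
def convFn (f : Rn n → EReal) (x : Rn n) : EReal :=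
  sInf {m : EReal | ∃ r : ℝ, m = (r : EReal) ∧ (x, r) ∈ convexHull ℝ (epi f)}

/-- Lower semicontinuous hull. -/
def clFn (f : Rn n → EReal) (x : Rn n) : EReal := liminf f (𝓝 x)

open Classical in
/-- Epi-multiplication by `a ≥ 0`: `a f(·/a)` if `a > 0`, the indicator of `{0}` if `a = 0`. -/
def epiMul (a : ℝ) (f : Rn n → EReal) (x : Rn n) : EReal :=
  if 0 < a then (a : EReal) * f (a⁻¹ • x) else indic {0} x

/-- Infimal convolution. -/
def infConv (f g : Rn n → EReal) (x : Rn n) : EReal :=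
  ⨅ u : Rn n, upAdd (f u) (g (x - u))

/-! ### Legendre functions -/

/-- Domain of the convex subdifferential. -/
def domSubdiff (f : Rn n → EReal) : Set (Rn n) :=
  {x | x ∈ effDom f ∧ ∃ v : Rn n, ∀ y, f x + ((inner ℝ v (y - x) : ℝ) : EReal) ≤ f y}

/-- Differentiable on the nonempty interior of the domain, with gradients blowing up in norm
at its boundary. -/
structure IsEssentiallySmooth (f : Rn n → EReal) : Prop where
  nonempty : (intDom f).Nonempty
  differentiableAt : ∀ x ∈ intDom f, DifferentiableAt ℝ (realVal f) x
  steep : ∀ (u : ℕ → Rn n) (x : Rn n), (∀ k, u k ∈ intDom f) → x ∈ frontier (intDom f) →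
    Tendsto u atTop (𝓝 x) → Tendsto (fun k => ‖gradient (realVal f) (u k)‖) atTop atTop

/-- Strictly convex on every convex subset of the domain of the subdifferential. -/
def IsEssentiallyStrictlyConvex (f : Rn n → EReal) : Prop :=
  ∀ C : Set (Rn n), C ⊆ domSubdiff f → Convex ℝ C → StrictConvexOn ℝ C (realVal f)

/-- Legendre type. -/
structure IsLegendre (f : Rn n → EReal) : Prop where
  gammaZero : IsGammaZero f
  smooth : IsEssentiallySmooth f
  strict : IsEssentiallyStrictlyConvex f

/-- `f(x)/‖x‖ → +∞` as `‖x‖ → +∞`. -/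
def IsOneCoercive (f : Rn n → EReal) : Prop :=
  Tendsto (fun x : Rn n => f x / ((‖x‖ : ℝ) : EReal)) (Bornology.cobounded (Rn n)) (𝓝 ⊤)

/-- The assumptions on `φ`: Legendre, 1-coercive, with closed domain on which `φ` is relatively
continuous, and `C²` on the interior of the domain with positive definite Hessian. -/
structure IsKernel (φ : Rn n → EReal) : Prop where
  legendre : IsLegendre φ
  coercive : IsOneCoercive φ
  closed_dom : IsClosed (effDom φ)
  continuousOn : ContinuousOn φ (effDom φ)
  contDiffOn : ContDiffOn ℝ 2 (realVal φ) (intDom φ)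
  hessian_pos : ∀ u ∈ intDom φ, ∀ v : Rn n, v ≠ 0 →
    0 < fderiv ℝ (fderiv ℝ (realVal φ)) u v v

/-! ### Bregman envelopes, prox-boundedness and the proximal average -/

open Classical in
/-- Bregman distance. -/
def bregDist (φ : Rn n → EReal) (x y : Rn n) : EReal :=
  if y ∈ intDom φ then
    φ x - φ y - ((inner ℝ (gradient (realVal φ) y) (x - y) : ℝ) : EReal)
  else ⊤

/-- Left Bregman envelope with parameter `l > 0`. -/
def bregEnv (φ : Rn n → EReal) (l : ℝ) (f : Rn n → EReal) (y : Rn n) : EReal :=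
  ⨅ x : Rn n, f x + ((1 / l : ℝ) : EReal) * bregDist φ x y

/-- Threshold of prox-boundedness: the supremum of all `l > 0` for which the envelope is `> -∞`
at some point of the interior of the domain of `φ`. It is `-∞` if there is no such `l`, that is,
if `f` is not prox-bounded. -/
def proxThreshold (φ f : Rn n → EReal) : EReal :=
  sSup {m : EReal | ∃ l : ℝ, 0 < l ∧ m = (l : EReal) ∧ ∃ y ∈ intDom φ, ⊥ < bregEnv φ l f y}

/-- The function `f + (1/l) φ`. -/
def shift (φ : Rn n → EReal) (l : ℝ) (f : Rn n → EReal) (x : Rn n) : EReal :=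
  f x + ((1 / l : ℝ) : EReal) * φ x

/-- The arithmetic average `a f₁ + (1-a) f₂`, with `0 · (+∞) = 0`. -/
def arithAvg (a : ℝ) (f₁ f₂ : Rn n → EReal) (x : Rn n) : EReal :=
  (a : EReal) * f₁ x + ((1 - a : ℝ) : EReal) * f₂ x

/-- The epi-average `(a ⋆ f₁) □ ((1-a) ⋆ f₂)`. -/
def epiAvg (a : ℝ) (f₁ f₂ : Rn n → EReal) : Rn n → EReal :=
  infConv (epiMul a f₁) (epiMul (1 - a) f₂)

/-- The `a`-weighted Bregman proximal average with parameter `l`: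
`[a (f₁ + φ/l)^* + (1-a) (f₂ + φ/l)^*]^* - φ/l`. -/
def proxAvg (φ f₁ f₂ : Rn n → EReal) (a l : ℝ) (x : Rn n) : EReal :=
  upSub (conj (arithAvg a (conj (shift φ l f₁)) (conj (shift φ l f₂))) x)
    (((1 / l : ℝ) : EReal) * φ x)

/-! ### Epi-convergence -/

/-- Epi-convergence of a sequence of functions at a point. -/
def EpiConvergesAt (F : ℕ → Rn n → EReal) (f : Rn n → EReal) (x : Rn n) : Prop :=
  (∀ u : ℕ → Rn n, Tendsto u atTop (𝓝 x) → f x ≤ liminf (fun k => F k (u k)) atTop) ∧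
  ∃ u : ℕ → Rn n, Tendsto u atTop (𝓝 x) ∧ Tendsto (fun k => F k (u k)) atTop (𝓝 (f x))

/-- Epi-convergence (on the whole space) of a family with a real parameter tending to its limit
along the filter `𝓕`: epi-convergence along every sequence of parameters tending to that limit. -/
def EpiTendsto (F : ℝ → Rn n → EReal) (𝓕 : Filter ℝ) (f : Rn n → EReal) : Prop :=
  ∀ l : ℕ → ℝ, Tendsto l atTop 𝓕 → ∀ x, EpiConvergesAt (fun k => F (l k)) f x

end BregmanAvg

end

open Filter Topology BregmanAvg

/-! All values of λ are read off from sets that do not depend on λ. Let Bᵢ ⊆ ℝⁿ × ℝ × ℝ be the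
triples (z, s, p) with fᵢ(z) ≤ s and φ(z) ≤ p (`liftEpi`). The epigraph of fᵢ + tφ is the image of
Bᵢ under (z, s, p) ↦ (z, s + tp), and linear images commute with convex hulls and Minkowski
averages. So the epi-average of the conv(fᵢ + tφ), minus tφ, is at x the infimum of s + t(p − φ(x))
over the (x, s, p) in α conv B₁ + (1 − α) conv B₂ (`tiltedAvg`). Convexity of φ forces p ≥ φ(x)
there. An infimum of nondecreasing affine functions of t is nondecreasing and right-continuous; with
t = 1/λ this gives the monotonicity and both pointwise limits at λ̄, where λ̄ = +∞ corresponds to t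
= 0.

The conjugate formula must therefore equal the epi-average of the convex hulls without any closure
(`conj_arithAvg_conj_lt_iff`). Below the threshold fᵢ + φ/λ is superlinear, and for closed
superlinear sets a compactness argument yields nonvertical separating hyperplanes with a common
slope (`exists_common_slope`).

For λ ↓ 0, a competitor with p = φ(x) bounds the average above by αf₁(x) + (1 − α)f₂(x). Testing the
outer conjugate at ∇φ(x)/λ bounds it below by averaged Bregman envelopes (`le_proxAvg`), and these
recover fᵢ(x) because the Bregman distance grows linearly away from x (`eventually_le_breg`).

Both epi-limits come from monotonicity: a decreasing limit produces the lower semicontinuous hull,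
and an increasing limit of lower semicontinuous functions is already an epi-limit. -/

open Filter Topology BregmanAvg

open scoped Pointwise

/-! ### Compactness of convex hulls in finite dimension -/

section CompactHull

variable {E : Type*} [AddCommGroup E] [Module ℝ E]

/-- Points that are obtained from `S` by `k` successive convex joins with `S`. -/
def iterJoin (S : Set E) : ℕ → Set E
  | 0 => S
  | k + 1 => convexJoin ℝ S (iterJoin S k)

theorem iterJoin_subset_convexHull (S : Set E) (k : ℕ) : iterJoin S k ⊆ convexHull ℝ S := by
  induction k with
  | zero => exact subset_convexHull ℝ S
  | succ k ih => exact convexJoin_subset (subset_convexHull ℝ S) ih (convex_convexHull ℝ S)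

theorem iterJoin_mono (S : Set E) {j k : ℕ} (h : j ≤ k) : iterJoin S j ⊆ iterJoin S k := by
  induction h with
  | refl => exact subset_rfl
  | step _ ih =>
    refine ih.trans fun x hx => ?_
    have hne : S.Nonempty := by
      by_contra hne
      have := iterJoin_subset_convexHull S _ hx
      simp [Set.not_nonempty_iff_eq_empty.mp hne] at this
    obtain ⟨s, hs⟩ := hne
    exact mem_convexJoin.mpr ⟨s, hs, x, hx, right_mem_segment ℝ s x⟩

theorem convexHull_finset_subset_iterJoin (S : Set E) (t : Finset E) (ht : (t : Set E) ⊆ S) :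
    convexHull ℝ (t : Set E) ⊆ iterJoin S t.card := by
  classical
  induction t using Finset.induction_on with
  | empty => simp
  | insert a t ha ih =>
    rw [Finset.coe_insert, Set.insert_subset_iff] at ht
    rw [Finset.coe_insert, Finset.card_insert_of_notMem ha]
    rcases (t : Set E).eq_empty_or_nonempty with h0 | h0
    · rw [h0]
      simp only [insert_empty_eq, convexHull_singleton, Set.singleton_subset_iff]
      exact iterJoin_mono S (Nat.zero_le _) ht.1
    · rw [convexHull_insert h0]
      exact convexJoin_mono (Set.singleton_subset_iff.mpr ht.1) (ih ht.2)

/-- Carathéodory bounds the number of points needed by dim + 1, so one fixed number of joins reaches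
the whole hull. -/
theorem convexHull_eq_iterJoin [FiniteDimensional ℝ E] (S : Set E) :
    convexHull ℝ S = iterJoin S (Module.finrank ℝ E + 1) := by
  refine subset_antisymm (fun x hx => ?_) (iterJoin_subset_convexHull S _)
  rw [convexHull_eq_union] at hx
  simp only [Set.mem_iUnion] at hx
  obtain ⟨t, hts, hind, hx⟩ := hx
  refine iterJoin_mono S ?_ (convexHull_finset_subset_iterJoin S t hts hx)
  simpa using hind.card_le_finrank_succ.trans
    (Nat.succ_le_succ (Submodule.finrank_le _))

variable [TopologicalSpace E] [IsTopologicalAddGroup E] [ContinuousSMul ℝ E]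

theorem isCompact_convexJoin {S T : Set E} (hS : IsCompact S) (hT : IsCompact T) :
    IsCompact (convexJoin ℝ S T) := by
  have : convexJoin ℝ S T =
      (fun q : ℝ × E × E => (1 - q.1) • q.2.1 + q.1 • q.2.2) '' (Set.Icc 0 1 ×ˢ S ×ˢ T) := by
    ext x
    simp only [mem_convexJoin, segment_eq_image, Set.mem_image, Set.mem_prod, Prod.exists]
    constructor
    · rintro ⟨a, ha, b, hb, θ, hθ, rfl⟩
      exact ⟨θ, a, b, ⟨hθ, ha, hb⟩, rfl⟩
    · rintro ⟨θ, a, b, ⟨hθ, ha, hb⟩, rfl⟩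
      exact ⟨a, ha, b, hb, θ, hθ, rfl⟩
  rw [this]
  exact (isCompact_Icc.prod (hS.prod hT)).image (by fun_prop)

/-- In finite dimension, the convex hull of a compact set is compact. -/
theorem IsCompact.convexHull_of_finiteDimensional [FiniteDimensional ℝ E] {S : Set E}
    (hS : IsCompact S) : IsCompact (convexHull ℝ S) := by
  have h : ∀ k, IsCompact (iterJoin S k) := by
    intro k
    induction k with
    | zero => exact hS
    | succ k ih => exact isCompact_convexJoin hS ih
  rw [convexHull_eq_iterJoin]
  exact h _

end CompactHull

/-! ### Separation from an average of hulls of superlinear sets -/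

section Separation


variable {E : Type*} [NormedAddCommGroup E] [InnerProductSpace ℝ E]

/-- A set in `E × ℝ` lying above all the cones `M ‖x‖ - c`, for suitable `c` depending on `M`. -/
def Superlinear (B : Set (E × ℝ)) : Prop :=
  ∀ M : ℝ, ∃ c : ℝ, ∀ p ∈ B, M * ‖p.1‖ - c ≤ p.2

/-- A closed superlinear set has, after homogenization and addition of the vertical direction,
a compact base. -/
theorem Superlinear.exists_compact_base [FiniteDimensional ℝ E] {B : Set (E × ℝ)}
    (hB : IsClosed B) (hs : Superlinear B) :
    ∃ K : Set (ℝ × E × ℝ), IsCompact K ∧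
      (∀ q ∈ K, (0 < q.1 ∧ q.1⁻¹ • q.2 ∈ B) ∨ q = (0, 0, 1)) ∧
      (∀ p ∈ B, ∃ τ : ℝ, 0 < τ ∧ (τ, τ • p) ∈ K) ∧ ((0, 0, 1) : ℝ × E × ℝ) ∈ K := by
  choose c hc using hs
  -- A normalized slice of the cone over B. The growth inequalities, homogenized by the height t,
  -- survive in the limit t = 0, where they leave only the vertical direction.
  let K : Set (ℝ × E × ℝ) :=
    {q | 0 ≤ q.1} ∩ {q | q.1 + ‖q.2.1‖ + |q.2.2| = 1} ∩
      (⋂ M : ℝ, {q | M * ‖q.2.1‖ - c M * q.1 ≤ q.2.2}) ∩ {q | 0 < q.1 ∧ q.1⁻¹ • q.2 ∉ B}ᶜ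
  have hopen : IsOpen {q : ℝ × E × ℝ | 0 < q.1 ∧ q.1⁻¹ • q.2 ∉ B} := by
    have hpos : IsOpen {q : ℝ × E × ℝ | 0 < q.1} := isOpen_lt continuous_const continuous_fst
    have hcont : ContinuousOn (fun q : ℝ × E × ℝ => q.1⁻¹ • q.2) {q | 0 < q.1} :=
      (continuousOn_fst.inv₀ fun q hq => ne_of_gt hq).smul continuousOn_snd
    exact hcont.isOpen_inter_preimage hpos hB.isOpen_compl
  have hclosed : IsClosed K := by
    refine ((IsClosed.inter ?_ ?_).inter (isClosed_iInter fun M => ?_)).inter hopen.isClosed_compl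
    · exact isClosed_le continuous_const continuous_fst
    · exact isClosed_eq (by fun_prop) continuous_const
    · exact isClosed_le (by fun_prop) (by fun_prop)
  refine ⟨K, ?_, ?_, ?_, ?_⟩
  · refine Metric.isCompact_of_isClosed_isBounded hclosed
      (isBounded_iff_forall_norm_le.mpr ⟨1, fun q hq => ?_⟩)
    obtain ⟨⟨⟨h0, h1⟩, -⟩, -⟩ := hq
    simp only [Set.mem_ofPred_eq] at h0 h1
    have := norm_nonneg q.2.1
    have := abs_nonneg q.2.2
    refine norm_prod_le_iff.mpr ⟨?_, norm_prod_le_iff.mpr ⟨?_, ?_⟩⟩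
    · rw [Real.norm_of_nonneg h0]; linarith
    · linarith
    · rw [Real.norm_eq_abs]; linarith
  · rintro ⟨t, z, s⟩ ⟨⟨⟨h0, h1⟩, h2⟩, h3⟩
    simp only [Set.mem_ofPred_eq, Set.mem_iInter, Set.mem_compl_iff, not_and, not_not] at h0 h1 h2 h3
    rcases h0.eq_or_lt with rfl | h0
    · right
      have hs0 : 0 ≤ s := by simpa using h2 0
      rw [abs_of_nonneg hs0] at h1
      have hz : ‖z‖ = 0 := by
        by_contra hz
        have hz : 0 < ‖z‖ := lt_of_le_of_ne (norm_nonneg z) (Ne.symm hz)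
        -- This slope would give s ≥ 2, against the normalization ‖z‖ + s = 1.
        have := h2 (2 / ‖z‖)
        rw [div_mul_cancel₀ _ hz.ne'] at this
        linarith
      rw [norm_eq_zero] at hz
      subst hz
      simp only [norm_zero, add_zero, zero_add] at h1
      rw [h1]
    · exact Or.inl ⟨h0, h3 h0⟩
  · rintro ⟨z, s⟩ hp
    have hN : 0 < 1 + ‖z‖ + |s| := by positivity
    refine ⟨(1 + ‖z‖ + |s|)⁻¹, by positivity, ⟨⟨⟨?_, ?_⟩, ?_⟩, ?_⟩⟩
    · simp only [Set.mem_ofPred_eq]; positivity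
    · simp only [Set.mem_ofPred_eq, Prod.smul_fst, Prod.smul_snd, norm_smul, smul_eq_mul, abs_mul,
        Real.norm_eq_abs, abs_inv, abs_of_pos hN]
      field_simp
    · simp only [Set.mem_ofPred_eq, Set.mem_iInter, Prod.smul_fst, Prod.smul_snd, norm_smul,
        smul_eq_mul, Real.norm_eq_abs, abs_inv, abs_of_pos hN]
      intro M
      have := mul_le_mul_of_nonneg_left (hc M _ hp) (inv_pos.mpr hN).le
      simp only at this
      linarith
    · simp only [Set.mem_compl_iff, Set.mem_ofPred_eq, not_and, not_not]
      intro h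
      rwa [smul_smul, inv_mul_cancel₀ h.ne', one_smul]
  · refine ⟨⟨⟨le_refl (0 : ℝ), ?_⟩, ?_⟩, ?_⟩ <;> simp

/-- The cone generated by two sets, both lifted to height one in a separate coordinate, and by the
vertical direction is convex. -/
theorem convex_conePair {B₁ B₂ : Set (E × ℝ)} :
    Convex ℝ {q : ℝ × ℝ × E × ℝ | 0 ≤ q.1 ∧ 0 ≤ q.2.1 ∧ ∃ a ∈ convexHull ℝ B₁,
      ∃ b ∈ convexHull ℝ B₂, ∃ s : ℝ, 0 ≤ s ∧ q.2.2 = q.1 • a + q.2.1 • b + ((0 : E), s)} := by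
  have key : ∀ (B : Set (E × ℝ)) (t t' : ℝ), 0 ≤ t → 0 ≤ t' → ∀ a ∈ convexHull ℝ B,
      ∀ a' ∈ convexHull ℝ B, ∃ d ∈ convexHull ℝ B, t • a + t' • a' = (t + t') • d := by
    intro B t t' ht ht' a ha a' ha'
    have : t • a + t' • a' ∈ (t + t') • convexHull ℝ B := by
      rw [(convex_convexHull ℝ B).add_smul ht ht']
      exact Set.add_mem_add (Set.smul_mem_smul_set ha) (Set.smul_mem_smul_set ha')
    obtain ⟨d, hd, h⟩ := this
    exact ⟨d, hd, h.symm⟩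
  rintro q ⟨h1, h2, a, ha, b, hb, s, hs, hq⟩ q' ⟨h1', h2', a', ha', b', hb', s', hs', hq'⟩ θ θ' hθ
    hθ' -
  obtain ⟨d, hd, hda⟩ := key B₁ (θ * q.1) (θ' * q'.1) (by positivity) (by positivity) a ha a' ha'
  obtain ⟨e, he, heb⟩ := key B₂ (θ * q.2.1) (θ' * q'.2.1) (by positivity) (by positivity) b hb b' hb'
  refine ⟨?_, ?_, d, hd, e, he, θ * s + θ' * s', by positivity, ?_⟩
  · simp only [Prod.fst_add, Prod.smul_fst, smul_eq_mul]; positivity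
  · simp only [Prod.fst_add, Prod.smul_fst, Prod.snd_add, Prod.smul_snd, smul_eq_mul]; positivity
  · simp only [Prod.fst_add, Prod.smul_fst, Prod.snd_add, Prod.smul_snd, smul_eq_mul, hq, hq',
      ← hda, ← heb]
    have : ((0 : E), θ * s + θ' * s') = θ • ((0 : E), s) + θ' • ((0 : E), s') := by simp
    rw [this]
    module

/-- A point lying below the weighted sum of the convex hulls of two closed superlinear sets is
separated from it by a pair of nonvertical hyperplanes with a common slope. -/
theorem exists_common_slope [FiniteDimensional ℝ E] {B₁ B₂ : Set (E × ℝ)}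
    (h₁ : IsClosed B₁) (h₂ : IsClosed B₂) (hs₁ : Superlinear B₁) (hs₂ : Superlinear B₂)
    (hn₁ : B₁.Nonempty) (hn₂ : B₂.Nonempty) {α : ℝ} {x : E} {r : ℝ}
    (hr : ∀ r' ≤ r, (x, r') ∉ α • convexHull ℝ B₁ + (1 - α) • convexHull ℝ B₂) :
    ∃ (y : E) (β₁ β₂ : ℝ), (∀ p ∈ B₁, inner ℝ y p.1 - p.2 ≤ β₁) ∧
      (∀ p ∈ B₂, inner ℝ y p.1 - p.2 ≤ β₂) ∧ r ≤ inner ℝ y x - α * β₁ - (1 - α) * β₂ := by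
  obtain ⟨K₁, hK₁, hm₁, hi₁, hv₁⟩ := hs₁.exists_compact_base h₁
  obtain ⟨K₂, hK₂, hm₂, hi₂, hv₂⟩ := hs₂.exists_compact_base h₂
  let i₁ : ℝ × E × ℝ → ℝ × ℝ × E × ℝ := fun q => (q.1, 0, q.2)
  let i₂ : ℝ × E × ℝ → ℝ × ℝ × E × ℝ := fun q => (0, q.1, q.2)
  let S := i₁ '' K₁ ∪ i₂ '' K₂
  have hS : IsCompact S :=
    (hK₁.image (by fun_prop)).union (hK₂.image (by fun_prop))
  obtain ⟨a₀, ha₀⟩ := hn₁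
  obtain ⟨b₀, hb₀⟩ := hn₂
  have hSW : convexHull ℝ S ⊆ {q : ℝ × ℝ × E × ℝ | 0 ≤ q.1 ∧ 0 ≤ q.2.1 ∧ ∃ a ∈ convexHull ℝ B₁,
      ∃ b ∈ convexHull ℝ B₂, ∃ s : ℝ, 0 ≤ s ∧ q.2.2 = q.1 • a + q.2.1 • b + ((0 : E), s)} := by
    refine convexHull_min ?_ convex_conePair
    rintro _ (⟨q, hq, rfl⟩ | ⟨q, hq, rfl⟩)
    · rcases hm₁ q hq with ⟨hpos, hB⟩ | rfl
      · exact ⟨hpos.le, le_rfl, _, subset_convexHull ℝ _ hB, b₀, subset_convexHull ℝ _ hb₀, 0,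
          le_rfl, by simp [i₁, smul_smul, mul_inv_cancel₀ hpos.ne']⟩
      · exact ⟨le_rfl, le_rfl, a₀, subset_convexHull ℝ _ ha₀, b₀, subset_convexHull ℝ _ hb₀, 1,
          zero_le_one, by simp [i₁]⟩
    · rcases hm₂ q hq with ⟨hpos, hB⟩ | rfl
      · exact ⟨le_rfl, hpos.le, a₀, subset_convexHull ℝ _ ha₀, _, subset_convexHull ℝ _ hB, 0,
          le_rfl, by simp [i₂, smul_smul, mul_inv_cancel₀ hpos.ne']⟩
      · exact ⟨le_rfl, le_rfl, a₀, subset_convexHull ℝ _ ha₀, b₀, subset_convexHull ℝ _ hb₀, 1,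
          zero_le_one, by simp [i₂]⟩
  -- A linear functional positive on S: superlinearity with M = 0 bounds the heights below by −cᵢ,
  -- and the extra 1 makes the inequality strict.
  have hS0 : (0 : ℝ × ℝ × E × ℝ) ∉ convexHull ℝ S := by
    obtain ⟨c₁, hc₁⟩ := hs₁ 0
    obtain ⟨c₂, hc₂⟩ := hs₂ 0
    have hsub : convexHull ℝ S ⊆
        {q : ℝ × ℝ × E × ℝ | 0 < (c₁ + 1) * q.1 + (c₂ + 1) * q.2.1 + q.2.2.2} := by
      refine convexHull_min ?_ (convex_halfSpace_gt (f := fun q : ℝ × ℝ × E × ℝ =>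
        (c₁ + 1) * q.1 + (c₂ + 1) * q.2.1 + q.2.2.2) ⟨?_, ?_⟩ 0)
      · rintro _ (⟨q, hq, rfl⟩ | ⟨q, hq, rfl⟩)
        · rcases hm₁ q hq with ⟨hpos, hB⟩ | rfl
          · have := hc₁ _ hB
            simp only [zero_mul, zero_sub, Prod.smul_snd, smul_eq_mul] at this
            have h := mul_le_mul_of_nonneg_left this hpos.le
            rw [mul_inv_cancel_left₀ hpos.ne'] at h
            simp only [Set.mem_ofPred_eq, i₁]
            linarith
          · simp [i₁]
        · rcases hm₂ q hq with ⟨hpos, hB⟩ | rfl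
          · have := hc₂ _ hB
            simp only [zero_mul, zero_sub, Prod.smul_snd, smul_eq_mul] at this
            have h := mul_le_mul_of_nonneg_left this hpos.le
            rw [mul_inv_cancel_left₀ hpos.ne'] at h
            simp only [Set.mem_ofPred_eq, i₂]
            linarith
          · simp [i₂]
      · intro p q; simp; ring
      · intro k p; simp; ring
    intro h0
    simpa using hsub h0
  -- If the ray through P met the hull of S, rescaling would place some (x, r') with r' ≤ r in the
  -- average. The two height coordinates record the weights, so α = 0 and α = 1 need no separate
  -- treatment.
  let P : ℝ × ℝ × E × ℝ := (α, 1 - α, x, r)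
  let R : Set (ℝ × ℝ × E × ℝ) := (fun k : ℝ => k • P) '' Set.Ici 0
  have hP : P ≠ 0 := by
    intro h
    simp only [P, Prod.mk_eq_zero] at h
    linarith [h.1, h.2.1]
  have hRc : Convex ℝ R := (convex_Ici 0).is_linear_image ⟨fun a b => add_smul a b P,
    fun a b => by simp [mul_smul]⟩
  have hRcl : IsClosed R := by
    have := (isClosedEmbedding_smul_left hP).isClosedMap (Set.Ici (0 : ℝ)) isClosed_Ici
    exact this
  have hdisj : Disjoint (convexHull ℝ S) R := by
    rw [Set.disjoint_left]
    rintro _ hq ⟨k, hk, rfl⟩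
    rcases (Set.mem_Ici.mp hk).eq_or_lt with rfl | hk
    · simp only [zero_smul] at hq
      exact hS0 hq
    · obtain ⟨-, -, a, ha, b, hb, s, hs, h⟩ := hSW hq
      simp only [P, Prod.smul_fst, Prod.smul_snd, smul_eq_mul] at h
      refine hr (r - k⁻¹ * s) (by have := mul_nonneg (inv_pos.mpr hk).le hs; linarith) ?_
      refine ⟨α • a, Set.smul_mem_smul_set ha, (1 - α) • b, Set.smul_mem_smul_set hb, ?_⟩
      have h' := congrArg (fun w => k⁻¹ • w) h
      simp only [smul_add, smul_smul, inv_mul_cancel_left₀ hk.ne', inv_mul_cancel₀ hk.ne',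
        one_smul] at h'
      have e : (x, r - k⁻¹ * s) = (x, r) - k⁻¹ • ((0 : E), s) := by simp
      simp only
      rw [e, h', add_sub_cancel_right]
  obtain ⟨ℓ, u, v, hℓS, huv, hℓR⟩ := geometric_hahn_banach_compact_closed
    (convex_convexHull ℝ S) hS.convexHull_of_finiteDimensional hRc hRcl hdisj
  have hv0 : v < 0 := by
    simpa using hℓR 0 ⟨0, Set.self_mem_Ici, by simp⟩
  have hℓP : 0 ≤ ℓ P := by
    by_contra hneg
    push Not at hneg
    have := hℓR ((v / ℓ P) • P) ⟨_, div_nonneg_of_nonpos hv0.le hneg.le, rfl⟩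
    rw [map_smul, smul_eq_mul, div_mul_cancel₀ _ hneg.ne] at this
    exact lt_irrefl _ this
  have hneg : ∀ q ∈ S, ℓ q < 0 := fun q hq =>
    (hℓS q (subset_convexHull ℝ _ hq)).trans (huv.trans hv0)
  let w : E := (InnerProductSpace.toDual ℝ E).symm
    (ℓ.comp ((ContinuousLinearMap.inr ℝ ℝ (ℝ × E × ℝ)).comp
      ((ContinuousLinearMap.inr ℝ ℝ (E × ℝ)).comp (ContinuousLinearMap.inl ℝ E ℝ))))
  have hw : ∀ z : E, inner ℝ w z = ℓ (0, 0, z, 0) := fun z => by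
    simp [w, InnerProductSpace.toDual_symm_apply]
  have hℓ : ∀ t t' z s, ℓ (t, t', z, s) = t * ℓ (1, 0, 0, 0) + t' * ℓ (0, 1, 0, 0) +
      inner ℝ w z + s * ℓ (0, 0, 0, 1) := by
    intro t t' z s
    have : ((t, t', z, s) : ℝ × ℝ × E × ℝ) = t • (1, 0, 0, 0) + t' • (0, 1, 0, 0) + (0, 0, z, 0) +
      s • (0, 0, 0, 1) := by simp
    rw [this, hw]
    simp only [map_add, map_smul, smul_eq_mul]
  set d := ℓ (0, 0, 0, 1)
  set e₁ := ℓ (1, 0, 0, 0)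
  set e₂ := ℓ (0, 1, 0, 0)
  -- The vertical direction lies in S, so the hyperplane is not vertical; dividing by −d normalizes
  -- its vertical coefficient to −1.
  have hd : d < 0 := hneg _ (Or.inl ⟨_, hv₁, rfl⟩)
  have hd' : 0 < (-d)⁻¹ := inv_pos.mpr (neg_pos.mpr hd)
  have hdd : (-d)⁻¹ * d = -1 := by rw [inv_neg, neg_mul, inv_mul_cancel₀ hd.ne]
  refine ⟨(-d)⁻¹ • w, -((-d)⁻¹ * e₁), -((-d)⁻¹ * e₂), ?_, ?_, ?_⟩
  · intro p hp
    obtain ⟨τ, hτ, hK⟩ := hi₁ p hp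
    have h1 := hneg _ (Or.inl ⟨_, hK, rfl⟩)
    have h2 : ℓ (1, 0, p.1, p.2) < 0 := by
      have : i₁ (τ, τ • p) = τ • ((1, 0, p.1, p.2) : ℝ × ℝ × E × ℝ) := by
        simp only [i₁, Prod.smul_mk, smul_eq_mul, mul_one, mul_zero, Prod.mk.injEq, true_and]
        rfl
      rw [this, map_smul, smul_eq_mul] at h1
      exact (mul_neg_iff.mp h1).elim (·.2) fun h => absurd hτ h.1.not_gt
    rw [hℓ] at h2
    have h3 := mul_neg_of_pos_of_neg hd' h2
    rw [inner_smul_left]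
    simp only [conj_trivial]
    have : (-d)⁻¹ * (p.2 * d) = -p.2 := by rw [mul_left_comm, hdd]; ring
    nlinarith
  · intro p hp
    obtain ⟨τ, hτ, hK⟩ := hi₂ p hp
    have h1 := hneg _ (Or.inr ⟨_, hK, rfl⟩)
    have h2 : ℓ (0, 1, p.1, p.2) < 0 := by
      have : i₂ (τ, τ • p) = τ • ((0, 1, p.1, p.2) : ℝ × ℝ × E × ℝ) := by
        simp only [i₂, Prod.smul_mk, smul_eq_mul, mul_one, mul_zero, Prod.mk.injEq, true_and]
        rfl
      rw [this, map_smul, smul_eq_mul] at h1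
      exact (mul_neg_iff.mp h1).elim (·.2) fun h => absurd hτ h.1.not_gt
    rw [hℓ] at h2
    have h3 := mul_neg_of_pos_of_neg hd' h2
    rw [inner_smul_left]
    simp only [conj_trivial]
    have : (-d)⁻¹ * (p.2 * d) = -p.2 := by rw [mul_left_comm, hdd]; ring
    nlinarith
  · rw [hℓ] at hℓP
    have h3 := mul_nonneg hd'.le hℓP
    rw [inner_smul_left]
    simp only [conj_trivial]
    have : (-d)⁻¹ * (r * d) = -r := by rw [mul_left_comm, hdd]; ring
    nlinarith

end Separation

namespace BregmanAvg

variable {n : ℕ}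

/-! ### Weighted averages of convex hulls -/

section Average

/-- The weighted Minkowski average of the convex hulls of two sets. -/
def avgSet {E : Type*} [AddCommGroup E] [Module ℝ E] (α : ℝ) (B₁ B₂ : Set E) : Set E :=
  α • convexHull ℝ B₁ + (1 - α) • convexHull ℝ B₂

theorem avgSet_image {E F : Type*} [AddCommGroup E] [Module ℝ E] [AddCommGroup F] [Module ℝ F]
    (T : E →ₗ[ℝ] F) (α : ℝ) (B₁ B₂ : Set E) :
    avgSet α (T '' B₁) (T '' B₂) = T '' avgSet α B₁ B₂ := by
  simp only [avgSet, Set.image_add, ← T.image_convexHull, image_smul_set]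

theorem mem_avgSet {E : Type*} [AddCommGroup E] [Module ℝ E] {α : ℝ} {B₁ B₂ : Set E} {x : E} :
    x ∈ avgSet α B₁ B₂ ↔ ∃ a ∈ convexHull ℝ B₁, ∃ b ∈ convexHull ℝ B₂,
      α • a + (1 - α) • b = x := by
  simp only [avgSet, Set.mem_add, Set.mem_smul_set]
  constructor
  · rintro ⟨_, ⟨a, ha, rfl⟩, _, ⟨b, hb, rfl⟩, h⟩
    exact ⟨a, ha, b, hb, h⟩
  · rintro ⟨a, ha, b, hb, h⟩
    exact ⟨_, ⟨a, ha, rfl⟩, _, ⟨b, hb, rfl⟩, h⟩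

/-- The average of two sets contained in a convex set is contained in that set. -/
theorem avgSet_subset {E : Type*} [AddCommGroup E] [Module ℝ E] {α : ℝ}
    (hα : α ∈ Set.Icc (0 : ℝ) 1) {B₁ B₂ C : Set E} (h₁ : B₁ ⊆ C) (h₂ : B₂ ⊆ C) (hC : Convex ℝ C) :
    avgSet α B₁ B₂ ⊆ C := by
  intro x hx
  obtain ⟨a, ha, b, hb, rfl⟩ := mem_avgSet.mp hx
  exact hC (convexHull_min h₁ hC ha) (convexHull_min h₂ hC hb) hα.1 (sub_nonneg.mpr hα.2)
    (by ring)

/-- A point that is common to the sets of positive weight belongs to the average. -/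
theorem smul_add_smul_mem_avgSet {E : Type*} [AddCommGroup E] [Module ℝ E] {α : ℝ}
    {B₁ B₂ : Set E} (h₁ : B₁.Nonempty) (h₂ : B₂.Nonempty) {a b : E} (ha : α = 0 ∨ a ∈ B₁)
    (hb : 1 - α = 0 ∨ b ∈ B₂) : α • a + (1 - α) • b ∈ avgSet α B₁ B₂ := by
  have key : ∀ {k : ℝ} {B : Set E}, B.Nonempty → ∀ {a : E}, k = 0 ∨ a ∈ B →
      ∃ d ∈ convexHull ℝ B, k • d = k • a := by
    rintro k B ⟨d, hd⟩ a (rfl | ha)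
    · exact ⟨d, subset_convexHull ℝ _ hd, by simp⟩
    · exact ⟨a, subset_convexHull ℝ _ ha, rfl⟩
  obtain ⟨d, hd, h1⟩ := key h₁ ha
  obtain ⟨e, he, h2⟩ := key h₂ hb
  exact mem_avgSet.mpr ⟨d, hd, e, he, by rw [h1, h2]⟩

end Average

/-! ### Real bounds for extended-real sums -/

section ERealLemmas

/-- Real strict upper bounds never produce ∞ − ∞; comparing such bounds is how the later identities
between extended-real functions are proved. -/
theorem upAdd_lt_iff {a b c : EReal} :
    upAdd a b < c ↔ ∃ r s : ℝ, a < r ∧ b < s ∧ ((r + s : ℝ) : EReal) < c := by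
  constructor
  · intro h
    have hab : ¬(a = ⊤ ∨ b = ⊤) := fun h' => by simp [upAdd, h'] at h
    rw [upAdd, if_neg hab] at h
    push Not at hab
    obtain ⟨d, h1, h2⟩ := EReal.lt_iff_exists_real_btwn.mp h
    suffices ∃ r s : ℝ, a < r ∧ b < s ∧ r + s = d by
      obtain ⟨r, s, hr, hs, rfl⟩ := this
      exact ⟨r, s, hr, hs, h2⟩
    induction a with
    | top => exact absurd rfl hab.1
    | bot =>
      induction b with
      | top => exact absurd rfl hab.2
      | bot => exact ⟨d, 0, EReal.bot_lt_coe _, EReal.bot_lt_coe _, by ring⟩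
      | coe b =>
        exact ⟨d - (b + 1), b + 1, EReal.bot_lt_coe _, EReal.coe_lt_coe_iff.mpr (by linarith),
          by ring⟩
    | coe a =>
      induction b with
      | top => exact absurd rfl hab.2
      | bot =>
        exact ⟨a + 1, d - (a + 1), EReal.coe_lt_coe_iff.mpr (by linarith), EReal.bot_lt_coe _,
          by ring⟩
      | coe b =>
        have h1 : a + b < d := by exact_mod_cast h1
        exact ⟨a + (d - a - b) / 2, b + (d - a - b) / 2, EReal.coe_lt_coe_iff.mpr (by linarith),
          EReal.coe_lt_coe_iff.mpr (by linarith), by ring⟩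
  · rintro ⟨r, s, hr, hs, h⟩
    rw [upAdd, if_neg (by rintro (rfl | rfl) <;> simp at hr hs)]
    exact (add_le_add hr.le hs.le).trans_lt (by rwa [← EReal.coe_add])

theorem coe_mul_lt_iff {a : ℝ} (ha : 0 < a) {e c : EReal} :
    (a : EReal) * e < c ↔ e < c / a := by
  rw [EReal.lt_div_iff (by exact_mod_cast ha) (EReal.coe_ne_top a), mul_comm]

theorem coe_mul_ne_bot {a : ℝ} (ha : 0 ≤ a) {e : EReal} (he : e ≠ ⊥) : (a : EReal) * e ≠ ⊥ := by
  induction e with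
  | bot => exact absurd rfl he
  | top =>
    rcases ha.eq_or_lt with rfl | ha
    · simp
    · rw [EReal.coe_mul_top_of_pos ha]; simp
  | coe e => rw [← EReal.coe_mul]; exact EReal.coe_ne_bot _

theorem exists_real_of_wsum_lt {a b : ℝ} (ha : 0 ≤ a) (hb : 0 ≤ b) {e f c : EReal} (he : e ≠ ⊥)
    (hf : f ≠ ⊥) (h : (a : EReal) * e + (b : EReal) * f < c) :
    ∃ s t : ℝ, (a = 0 ∨ e ≤ s) ∧ (b = 0 ∨ f ≤ t) ∧ ((a * s + b * t : ℝ) : EReal) < c := by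
  have key : ∀ {a : ℝ} {e g : EReal}, 0 ≤ a → e ≠ ⊥ → g ≠ ⊥ → (a : EReal) * e + g < c →
      (a = 0 ∨ e ≤ (e.toReal : ℝ)) ∧ (a : EReal) * e = ((a * e.toReal : ℝ) : EReal) := by
    intro a e g ha he hg h
    -- With weight 0 the value may be +∞: `toReal` then returns 0, which is harmless since 0 · (+∞)
    -- = 0.
    rcases ha.eq_or_lt with rfl | ha
    · simp
    · have : e ≠ ⊤ := by
        rintro rfl
        rw [EReal.coe_mul_top_of_pos ha, EReal.top_add_of_ne_bot hg] at h
        exact not_top_lt h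
      rw [EReal.coe_mul, EReal.coe_toReal this he]
      exact ⟨Or.inr le_rfl, rfl⟩
  obtain ⟨h1, h2⟩ := key ha he (coe_mul_ne_bot hb hf) h
  obtain ⟨h3, h4⟩ := key hb hf (coe_mul_ne_bot ha he) (by rwa [add_comm])
  refine ⟨_, _, h1, h3, ?_⟩
  rwa [h2, h4, ← EReal.coe_add] at h

theorem exists_real_of_lt_wsum {a b : ℝ} (ha : 0 ≤ a) (hb : 0 ≤ b) {e f : EReal} {c : ℝ}
    (he : e ≠ ⊥) (hf : f ≠ ⊥) (h : (c : EReal) < (a : EReal) * e + (b : EReal) * f) :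
    ∃ s t : ℝ, (s : EReal) < e ∧ (t : EReal) < f ∧ c < a * s + b * t := by
  have key : ∀ {a : ℝ} {e : EReal} {d : ℝ}, 0 ≤ a → e ≠ ⊥ → (d : EReal) < (a : EReal) * e →
      ∃ s : ℝ, (s : EReal) < e ∧ d < a * s := by
    intro a e d ha he h
    rcases ha.eq_or_lt with rfl | ha
    · obtain ⟨s, -, hs⟩ := EReal.lt_iff_exists_real_btwn.mp (bot_lt_iff_ne_bot.mpr he)
      have : d < 0 := by simpa using h
      exact ⟨s, hs, by simpa⟩
    · have h' : ((d / a : ℝ) : EReal) < e := by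
        rw [EReal.coe_div, EReal.div_lt_iff (by exact_mod_cast ha) (EReal.coe_ne_top a), mul_comm]
        exact h
      obtain ⟨s, hs, hs'⟩ := EReal.lt_iff_exists_real_btwn.mp h'
      refine ⟨s, hs', ?_⟩
      rw [mul_comm]
      exact (div_lt_iff₀ ha).mp (by exact_mod_cast hs)
  obtain ⟨d, d', hd, hd', hc⟩ : ∃ d d' : ℝ, (d : EReal) < a * e ∧ (d' : EReal) < b * f ∧
      c ≤ d + d' := by
    obtain ⟨u, hu, v, hv, hv'⟩ : ∃ u < (a : EReal) * e, ∃ v < (b : EReal) * f,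
        (c : EReal) < u + v := by
      by_contra hcon
      push Not at hcon
      exact absurd (EReal.add_le_of_forall_lt hcon) h.not_ge
    have hub : u ≠ ⊥ := by rintro rfl; simp at hv'
    have hvb : v ≠ ⊥ := by rintro rfl; simp at hv'
    refine ⟨u.toReal, v.toReal, ?_, ?_, ?_⟩
    · rwa [EReal.coe_toReal hu.ne_top hub]
    · rwa [EReal.coe_toReal hv.ne_top hvb]
    · rw [← EReal.coe_le_coe_iff, EReal.coe_add, EReal.coe_toReal hu.ne_top hub,
        EReal.coe_toReal hv.ne_top hvb]
      exact hv'.le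
  obtain ⟨s, hs, h1⟩ := key ha he hd
  obtain ⟨t, ht, h2⟩ := key hb hf hd'
  exact ⟨s, t, hs, ht, by linarith⟩

end ERealLemmas

/-! ### Epi-averages of convex hulls through their epigraphs -/

section EpiAverage

theorem convFn_lt_iff {f : Rn n → EReal} {x : Rn n} {c : EReal} :
    convFn f x < c ↔ ∃ r : ℝ, (r : EReal) < c ∧ (x, r) ∈ convexHull ℝ (epi f) := by
  rw [convFn, sInf_lt_iff]
  constructor
  · rintro ⟨_, ⟨r, rfl, h⟩, hr⟩
    exact ⟨r, hr, h⟩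
  · rintro ⟨r, hr, h⟩
    exact ⟨_, ⟨r, rfl, h⟩, hr⟩

theorem epiMul_convFn_lt_iff {f : Rn n → EReal} (hf : (epi f).Nonempty) {a : ℝ} (ha : 0 ≤ a)
    {u : Rn n} {c : EReal} :
    epiMul a (convFn f) u < c ↔ ∃ r : ℝ, (r : EReal) < c ∧ (u, r) ∈ a • convexHull ℝ (epi f) := by
  rcases ha.eq_or_lt with rfl | ha
  -- Nonemptiness makes the zero multiple of the hull the origin, in accordance with the convention
  -- 0 ⋆ g = ι_{0}.
  · rw [Set.zero_smul_set hf.convexHull, epiMul, if_neg (lt_irrefl _), indic]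
    by_cases hu : u = 0 <;> simp [hu]
  · rw [epiMul, if_pos ha, coe_mul_lt_iff ha, convFn_lt_iff]
    constructor
    · rintro ⟨r, hr, h⟩
      refine ⟨a * r, ?_, (a⁻¹ • u, r), h, by simp [smul_smul, mul_inv_cancel₀ ha.ne']⟩
      rw [EReal.coe_mul]
      exact (coe_mul_lt_iff ha).mpr hr
    · rintro ⟨_, hr, ⟨z, r⟩, h, heq⟩
      simp only [Prod.smul_mk, smul_eq_mul, Prod.mk.injEq] at heq
      obtain ⟨rfl, rfl⟩ := heq
      refine ⟨r, (coe_mul_lt_iff ha).mp (by rwa [EReal.coe_mul] at hr), ?_⟩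
      rwa [inv_smul_smul₀ ha.ne']

/-- Strict sublevel description of the epi-average of two convex hulls. -/
theorem epiAvg_convFn_lt_iff {f g : Rn n → EReal} (hf : (epi f).Nonempty) (hg : (epi g).Nonempty)
    {α : ℝ} (hα : α ∈ Set.Icc (0 : ℝ) 1) {x : Rn n} {c : EReal} :
    epiAvg α (convFn f) (convFn g) x < c ↔
      ∃ r : ℝ, (r : EReal) < c ∧ (x, r) ∈ avgSet α (epi f) (epi g) := by
  simp only [epiAvg, infConv, iInf_lt_iff, upAdd_lt_iff,
    epiMul_convFn_lt_iff hf hα.1, epiMul_convFn_lt_iff hg (sub_nonneg.mpr hα.2)]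
  constructor
  · rintro ⟨u, r, s, ⟨r', hr, hu⟩, ⟨s', hs, hv⟩, h⟩
    have hr' : r' < r := by exact_mod_cast hr
    have hs' : s' < s := by exact_mod_cast hs
    exact ⟨r' + s', (EReal.coe_le_coe_iff.mpr (by linarith)).trans_lt h, _, hu, _, hv, by simp⟩
  · rintro ⟨r, hr, ⟨u, s⟩, hu, ⟨v, t⟩, hv, h⟩
    simp only [Prod.mk_add_mk, Prod.mk.injEq] at h
    obtain ⟨rfl, rfl⟩ := h
    obtain ⟨d, h1, h2⟩ := EReal.lt_iff_exists_real_btwn.mp hr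
    have h1 : s + t < d := by exact_mod_cast h1
    refine ⟨u, s + (d - s - t) / 2, t + (d - s - t) / 2, ⟨s, ?_, hu⟩, ⟨t, ?_, ?_⟩, ?_⟩
    · exact EReal.coe_lt_coe_iff.mpr (by linarith)
    · exact EReal.coe_lt_coe_iff.mpr (by linarith)
    · rwa [add_sub_cancel_left]
    · rwa [show s + (d - s - t) / 2 + (t + (d - s - t) / 2) = d by ring]

end EpiAverage

/-! ### The conjugate of an average of conjugates -/

section Conjugate

theorem conj_le_coe_iff {g : Rn n → EReal} {y : Rn n} {β : ℝ} :
    conj g y ≤ β ↔ ∀ p ∈ epi g, inner ℝ y p.1 - p.2 ≤ β := by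
  rw [conj, iSup_le_iff]
  constructor
  · rintro h ⟨z, s⟩ hp
    have h1 := (EReal.sub_le_sub le_rfl hp).trans (h z)
    rw [← EReal.coe_sub] at h1
    exact_mod_cast h1
  · intro h z
    generalize hz : g z = e
    induction e with
    | top => simp
    | bot =>
      have := h (z, inner ℝ y z - β - 1) (by simp [epi, hz])
      simp only at this
      linarith
    | coe e =>
      have := h (z, e) (by simp [epi, hz])
      rw [← EReal.coe_sub]
      exact_mod_cast this

theorem exists_conj_eq_coe {g : Rn n → EReal} (hne : (epi g).Nonempty) (hs : Superlinear (epi g))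
    (y : Rn n) : ∃ β : ℝ, conj g y = β := by
  obtain ⟨c, hc⟩ := hs ‖y‖
  have h1 : conj g y ≤ c := conj_le_coe_iff.mpr fun p hp => by
    have := hc p hp
    have := real_inner_le_norm y p.1
    linarith
  have h2 : conj g y ≠ ⊥ := by
    intro h
    obtain ⟨p, hp⟩ := hne
    have := conj_le_coe_iff (β := inner ℝ y p.1 - p.2 - 1).mp (by rw [h]; exact bot_le) p hp
    linarith
  exact ⟨_, (EReal.coe_toReal (ne_top_of_le_ne_top (EReal.coe_ne_top c) h1) h2).symm⟩

/-- Obtained by testing the outer supremum at the single slope y. It turns a common slope into a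
lower bound, both in the duality formula and for small λ. -/
theorem le_conj_arithAvg_conj {g₁ g₂ : Rn n → EReal} {α : ℝ} (hα : α ∈ Set.Icc (0 : ℝ) 1)
    {y : Rn n} {β₁ β₂ : ℝ} (h₁ : conj g₁ y ≤ β₁) (h₂ : conj g₂ y ≤ β₂) (x : Rn n) :
    ((inner ℝ y x - α * β₁ - (1 - α) * β₂ : ℝ) : EReal) ≤
      conj (arithAvg α (conj g₁) (conj g₂)) x := by
  have h : arithAvg α (conj g₁) (conj g₂) y ≤ ((α * β₁ + (1 - α) * β₂ : ℝ) : EReal) := by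
    rw [arithAvg, EReal.coe_add, EReal.coe_mul, EReal.coe_mul]
    exact add_le_add (mul_le_mul_of_nonneg_left h₁ (by exact_mod_cast hα.1))
      (mul_le_mul_of_nonneg_left h₂ (by exact_mod_cast sub_nonneg.mpr hα.2))
  refine le_trans ?_ (le_iSup _ y)
  refine le_trans ?_ (EReal.sub_le_sub le_rfl h)
  rw [← EReal.coe_sub, real_inner_comm, EReal.coe_le_coe_iff]
  linarith

/-- Strict sublevel description of the conjugate of an average of conjugates: for closed
superlinear functions it is the epi-average of the convex hulls. -/
theorem conj_arithAvg_conj_lt_iff {g₁ g₂ : Rn n → EReal} (hc₁ : IsClosed (epi g₁))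
    (hc₂ : IsClosed (epi g₂)) (hs₁ : Superlinear (epi g₁)) (hs₂ : Superlinear (epi g₂))
    (hn₁ : (epi g₁).Nonempty) (hn₂ : (epi g₂).Nonempty) {α : ℝ} (hα : α ∈ Set.Icc (0 : ℝ) 1)
    {x : Rn n} {c : EReal} :
    conj (arithAvg α (conj g₁) (conj g₂)) x < c ↔
      ∃ r : ℝ, (r : EReal) < c ∧ (x, r) ∈ avgSet α (epi g₁) (epi g₂) := by
  constructor
  · intro h
    by_contra hcon
    push Not at hcon
    obtain ⟨r, h1, h2⟩ := EReal.lt_iff_exists_real_btwn.mp h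
    -- If no point of the average lay over x below c, the common slope would push the biconjugate up
    -- to r, which lies strictly above it.
    obtain ⟨y, β₁, β₂, hβ₁, hβ₂, hr⟩ := exists_common_slope hc₁ hc₂ hs₁ hs₂ hn₁ hn₂ (α := α)
      (x := x) (r := r) fun r' hr' => hcon r' ((EReal.coe_le_coe_iff.mpr hr').trans_lt h2)
    have := le_conj_arithAvg_conj hα (conj_le_coe_iff.mpr hβ₁) (conj_le_coe_iff.mpr hβ₂) x
    exact absurd ((EReal.coe_le_coe_iff.mpr hr).trans this) h1.not_ge
  · rintro ⟨r, hr, hmem⟩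
    refine lt_of_le_of_lt (iSup_le fun y => ?_) hr
    obtain ⟨β₁, hβ₁⟩ := exists_conj_eq_coe hn₁ hs₁ y
    obtain ⟨β₂, hβ₂⟩ := exists_conj_eq_coe hn₂ hs₂ y
    obtain ⟨a, ha, b, hb, hab⟩ := mem_avgSet.mp hmem
    have key : ∀ (g : Rn n → EReal) (β : ℝ), conj g y = β → ∀ p ∈ convexHull ℝ (epi g),
        inner ℝ y p.1 - p.2 ≤ β := by
      intro g β hβ p hp
      refine convexHull_min (s := epi g) (t := {p : Rn n × ℝ | inner ℝ y p.1 - p.2 ≤ β})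
        (conj_le_coe_iff.mp hβ.le) (convex_halfSpace_le ⟨?_, ?_⟩ β) hp
      · intro p q; simp only [Prod.fst_add, Prod.snd_add, inner_add_right]; ring
      · intro k p; simp only [Prod.smul_fst, Prod.smul_snd, inner_smul_right, smul_eq_mul]; ring
    have h1 := mul_le_mul_of_nonneg_left (key _ _ hβ₁ a ha) hα.1
    have h2 := mul_le_mul_of_nonneg_left (key _ _ hβ₂ b hb) (sub_nonneg.mpr hα.2)
    obtain ⟨rfl, rfl⟩ := Prod.mk.inj (hab.symm : (x, r) = (_, _))
    rw [arithAvg, hβ₁, hβ₂, ← EReal.coe_mul, ← EReal.coe_mul, ← EReal.coe_add, ← EReal.coe_sub,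
      EReal.coe_le_coe_iff]
    simp only [Prod.smul_fst, Prod.smul_snd, smul_eq_mul]
    rw [real_inner_comm, inner_add_right, inner_smul_right, inner_smul_right]
    linarith

end Conjugate

end BregmanAvg

namespace BregmanAvg

variable {n : ℕ}

/-! ### Convexity and superlinear growth of the kernel -/

section Kernel

variable {φ : Rn n → EReal}

theorem realVal_eq {v : ℝ} {x : Rn n} (h : φ x = v) : realVal φ x = v := by
  rw [realVal, h, EReal.toReal_coe]

theorem IsProper.coe_realVal (hφ : IsProper φ) {x : Rn n} (hx : x ∈ effDom φ) :
    φ x = (realVal φ x : ℝ) :=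
  (EReal.coe_toReal (ne_of_lt hx) (hφ.1 x)).symm

theorem IsProper.exists_coe_eq (hφ : IsProper φ) {x : Rn n} {r : ℝ} (hx : φ x ≤ r) :
    ∃ v : ℝ, φ x = v ∧ v ≤ r := by
  have hd : x ∈ effDom φ := lt_of_le_of_lt hx (EReal.coe_lt_top r)
  refine ⟨_, hφ.coe_realVal hd, ?_⟩
  rw [hφ.coe_realVal hd] at hx
  exact_mod_cast hx

theorem IsGammaZero.convexOn (hφ : IsGammaZero φ) : ConvexOn ℝ (effDom φ) (realVal φ) := by
  have key : ∀ ⦃x⦄, x ∈ effDom φ → ∀ ⦃y⦄, y ∈ effDom φ → ∀ ⦃a b : ℝ⦄, 0 ≤ a → 0 ≤ b → a + b = 1 →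
      φ (a • x + b • y) ≤ ((a • realVal φ x + b • realVal φ y : ℝ) : EReal) :=
    fun x hx y hy a b ha hb hab =>
      hφ.convex (x := (x, realVal φ x)) (hφ.proper.coe_realVal hx).le (y := (y, realVal φ y))
        (hφ.proper.coe_realVal hy).le ha hb hab
  have hconv : Convex ℝ (effDom φ) := fun x hx y hy a b ha hb hab =>
    (key hx hy ha hb hab).trans_lt (EReal.coe_lt_top _)
  refine ⟨hconv, fun x hx y hy a b ha hb hab => ?_⟩
  have := key hx hy ha hb hab
  rw [hφ.proper.coe_realVal (hconv hx hy ha hb hab)] at this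
  exact_mod_cast this

theorem intDom_subset : intDom φ ⊆ effDom φ := interior_subset

theorem gradient_le_of_convexOn {E : Type*} [NormedAddCommGroup E] [InnerProductSpace ℝ E]
    [CompleteSpace E] {S : Set E} {f : E → ℝ} (hf : ConvexOn ℝ S f) {x y : E} (hx : x ∈ S)
    (hy : y ∈ S) (hd : DifferentiableAt ℝ f y) : f y + inner ℝ (gradient f y) (x - y) ≤ f x := by
  let γ : ℝ →ᵃ[ℝ] E := AffineMap.lineMap y x
  have hγ : ConvexOn ℝ (γ ⁻¹' S) (f ∘ γ) := hf.comp_affineMap γ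
  have hder : HasDerivAt (f ∘ γ) (inner ℝ (gradient f y) (x - y)) 0 := by
    have h1 : HasDerivAt γ (x - y) 0 := AffineMap.hasDerivAt_lineMap
    have h2 : HasFDerivAt f (fderiv ℝ f y) (γ 0) := by
      simpa [γ] using hd.hasFDerivAt
    have h3 := h2.comp_hasDerivAt (0 : ℝ) h1
    rwa [gradient, InnerProductSpace.toDual_symm_apply]
  have := hγ.le_slope_of_hasDerivAt (x := 0) (y := 1) (by simpa [γ] using hy)
    (by simpa [γ] using hx) one_pos hder
  simp only [slope, γ, Function.comp, AffineMap.lineMap_apply_zero, AffineMap.lineMap_apply_one,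
    sub_zero, inv_one, one_smul, vsub_eq_sub] at this
  linarith

theorem IsKernel.gradient_le (hφ : IsKernel φ) {x y : Rn n} (hy : y ∈ intDom φ) {v : ℝ}
    (hx : φ x = v) : realVal φ y + inner ℝ (gradient (realVal φ) y) (x - y) ≤ v := by
  have := gradient_le_of_convexOn hφ.legendre.gammaZero.convexOn (x := x) (y := y)
    (by rw [effDom, Set.mem_ofPred_eq, hx]; exact EReal.coe_lt_top v) (intDom_subset hy)
    (hφ.legendre.smooth.differentiableAt y hy)
  rwa [realVal_eq hx] at this

theorem IsKernel.superlinear (hφ : IsKernel φ) : Superlinear (epi φ) := by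
  obtain ⟨y, hy⟩ := hφ.legendre.smooth.nonempty
  intro M
  have hM : ∀ᶠ x in Bornology.cobounded (Rn n), (M : EReal) < φ x / ((‖x‖ : ℝ) : EReal) :=
    hφ.coercive.eventually (lt_mem_nhds (EReal.coe_lt_top M))
  obtain ⟨R, hR⟩ := (hasBasis_cobounded_norm.eventually_iff).mp hM
  set g := gradient (realVal φ) y
  -- Outside the ball of radius |R| coercivity suffices with constant 0; inside it, the affine
  -- minorant of φ at y gives the second constant.
  refine ⟨max 0 (|M| * |R| - (realVal φ y - ‖g‖ * (|R| + ‖y‖))), ?_⟩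
  rintro ⟨z, s⟩ hz
  obtain ⟨v, hv, hvs⟩ := hφ.legendre.gammaZero.proper.exists_coe_eq (show φ z ≤ s from hz)
  refine le_trans ?_ hvs
  simp only
  rcases lt_or_ge |R| ‖z‖ with hzR | hzR
  · have hz0 : 0 < ‖z‖ := (abs_nonneg R).trans_lt hzR
    have h := hR.2 (show z ∈ {x | R ≤ ‖x‖} from (le_abs_self R).trans hzR.le)
    rw [hv, ← EReal.coe_div, EReal.coe_lt_coe_iff, lt_div_iff₀ hz0] at h
    linarith [le_max_left 0 (|M| * |R| - (realVal φ y - ‖g‖ * (|R| + ‖y‖)))]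
  · have h1 := hφ.gradient_le hy hv
    have h2 : -(‖g‖ * (|R| + ‖y‖)) ≤ inner ℝ g (z - y) := by
      have h3 := neg_le_of_abs_le (abs_real_inner_le_norm g (z - y))
      have h4 : ‖z - y‖ ≤ |R| + ‖y‖ := (norm_sub_le z y).trans (by linarith)
      have := mul_le_mul_of_nonneg_left h4 (norm_nonneg g)
      linarith
    have h5 : M * ‖z‖ ≤ |M| * |R| :=
      mul_le_mul (le_abs_self M) hzR (norm_nonneg z) (abs_nonneg M)
    linarith [le_max_right 0 (|M| * |R| - (realVal φ y - ‖g‖ * (|R| + ‖y‖)))]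

end Kernel

/-! ### The functions f + φ/λ and their lifted epigraphs -/

section Shift

variable {φ f : Rn n → EReal}

/-- Real form of the lower bound in the definition of prox-boundedness. -/
theorem exists_breg_bound (hφ : IsKernel φ) {l : ℝ} (hl : (l : EReal) < proxThreshold φ f) :
    ∃ l' : ℝ, l < l' ∧ 0 < l' ∧ ∃ y ∈ intDom φ, ∃ c : ℝ, ∀ (z : Rn n) (s v : ℝ), f z ≤ s →
      φ z = v → c ≤ s + 1 / l' * (v - realVal φ y - inner ℝ (gradient (realVal φ) y) (z - y)) := by
  obtain ⟨_, ⟨l', hl', rfl, y, hy, hbot⟩, hlt⟩ := lt_sSup_iff.mp hl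
  obtain ⟨c, -, hc⟩ := EReal.lt_iff_exists_real_btwn.mp hbot
  refine ⟨l', by exact_mod_cast hlt, hl', y, hy, c, fun z s v hs hv => ?_⟩
  have h := hc.le.trans (iInf_le _ z)
  rw [bregDist, if_pos hy, hv, hφ.legendre.gammaZero.proper.coe_realVal (intDom_subset hy),
    ← EReal.coe_sub, ← EReal.coe_sub, ← EReal.coe_mul] at h
  have h2 := h.trans (add_le_add_left hs _)
  rw [← EReal.coe_add] at h2
  exact_mod_cast h2

/-- Pairs of upper bounds for the values of `f` and of `φ`. -/
def liftEpi (φ f : Rn n → EReal) : Set (Rn n × ℝ × ℝ) := {q | f q.1 ≤ q.2.1 ∧ φ q.1 ≤ q.2.2}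

/-- The linear map `(z, s, p) ↦ (z, s + t p)`. -/
def tilt (t : ℝ) : (Rn n × ℝ × ℝ) →ₗ[ℝ] (Rn n × ℝ) where
  toFun q := (q.1, q.2.1 + t * q.2.2)
  map_add' p q := by ext <;> simp; ring
  map_smul' k q := by ext <;> simp; ring

theorem tilt_apply (t : ℝ) (q : Rn n × ℝ × ℝ) : tilt t q = (q.1, q.2.1 + t * q.2.2) := rfl

theorem epi_shift (hφ : IsProper φ) (hf : IsProper f) {l : ℝ} (hl : 0 < l) :
    epi (shift φ l f) = tilt (1 / l) '' liftEpi φ f := by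
  have hl' : 0 < 1 / l := one_div_pos.mpr hl
  ext ⟨z, r⟩
  constructor
  · intro h
    have h : f z + ((1 / l : ℝ) : EReal) * φ z ≤ r := h
    have hfb := hf.1 z
    have hφb := hφ.1 z
    have hφt : φ z ≠ ⊤ := by
      intro ht
      rw [ht, EReal.coe_mul_top_of_pos hl', EReal.add_top_of_ne_bot hfb] at h
      exact absurd h (EReal.coe_lt_top r).not_ge
    obtain ⟨v, hv⟩ : ∃ v : ℝ, φ z = v := ⟨_, (EReal.coe_toReal hφt hφb).symm⟩
    refine ⟨(z, r - 1 / l * v, v), ⟨?_, hv.le⟩, by simp [tilt_apply]⟩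
    rw [hv, ← EReal.coe_mul] at h
    simp only [EReal.coe_sub]
    rwa [EReal.le_sub_iff_add_le (Or.inl (EReal.coe_ne_bot _)) (Or.inl (EReal.coe_ne_top _))]
  · rintro ⟨⟨z', s, p⟩, ⟨h1, h2⟩, h⟩
    obtain ⟨rfl, rfl⟩ := Prod.mk.inj h
    change f z' + ((1 / l : ℝ) : EReal) * φ z' ≤ ((s + 1 / l * p : ℝ) : EReal)
    rw [EReal.coe_add, EReal.coe_mul (1 / l) p]
    exact add_le_add h1 (mul_le_mul_of_nonneg_left h2 (by exact_mod_cast hl'.le))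

/-- At tilt 0 the coordinate p contributes nothing to the height; its mere existence keeps the point
in dom φ. Hence the indicator in the limit λ ↑ +∞. -/
theorem epi_add_indic (hφ : IsProper φ) (hf : IsProper f) :
    epi (fun z => f z + indic (effDom φ) z) = tilt 0 '' liftEpi φ f := by
  ext ⟨z, r⟩
  constructor
  · intro h
    have h : f z + indic (effDom φ) z ≤ r := h
    by_cases hz : z ∈ effDom φ
    · rw [indic, if_pos hz, add_zero] at h
      exact ⟨(z, r, realVal φ z), ⟨h, (hφ.coe_realVal hz).le⟩, by simp [tilt_apply]⟩
    · rw [indic, if_neg hz, EReal.add_top_of_ne_bot (hf.1 z)] at h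
      exact absurd h (EReal.coe_lt_top r).not_ge
  · rintro ⟨⟨z', s, p⟩, ⟨h1, h2⟩, h⟩
    obtain ⟨rfl, rfl⟩ := Prod.mk.inj h
    have hz : z' ∈ effDom φ := lt_of_le_of_lt h2 (EReal.coe_lt_top p)
    simpa [epi, indic, hz] using h1

theorem liftEpi_nonempty (hφ : IsProper φ) (hf : IsProper f)
    (h : (effDom f ∩ effDom φ).Nonempty) : (liftEpi φ f).Nonempty := by
  obtain ⟨x, hx, hx'⟩ := h
  exact ⟨(x, realVal f x, realVal φ x), (hf.coe_realVal hx).le, (hφ.coe_realVal hx').le⟩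

/-- Choose l' > l at which the envelope is bounded below. Then f + φ/l' has an affine minorant, and
the remainder (1/l − 1/l')φ is a positive multiple of a superlinear function. -/
theorem superlinear_epi_shift (hφ : IsKernel φ) (hf : IsProper f) {l : ℝ} (hl : 0 < l)
    (hlt : (l : EReal) < proxThreshold φ f) : Superlinear (epi (shift φ l f)) := by
  have hp := hφ.legendre.gammaZero.proper
  obtain ⟨l', hll', hl', y, hy, c, hc⟩ := exists_breg_bound hφ hlt
  set g := gradient (realVal φ) y
  set k := 1 / l - 1 / l' with hk
  have hkpos : 0 < k := sub_pos.mpr (one_div_lt_one_div_of_lt hl hll')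
  intro M
  obtain ⟨d, hd⟩ := hφ.superlinear ((M + 1 / l' * ‖g‖) / k)
  refine ⟨k * d - c - 1 / l' * (realVal φ y - inner ℝ g y), ?_⟩
  rw [epi_shift hp hf hl]
  rintro _ ⟨⟨z, s, p⟩, ⟨h1, h2⟩, rfl⟩
  obtain ⟨v, hv, hvp⟩ := hp.exists_coe_eq h2
  have e1 := hc z s v h1 hv
  have e2 := hd (z, v) hv.le
  simp only [tilt_apply] at *
  have e3 : M * ‖z‖ + 1 / l' * ‖g‖ * ‖z‖ - k * d ≤ k * v := by
    have := mul_le_mul_of_nonneg_left e2 hkpos.le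
    rw [mul_sub, ← mul_assoc, mul_div_cancel₀ _ hkpos.ne'] at this
    linarith
  have e4 : 1 / l' * -(‖g‖ * ‖z‖) ≤ 1 / l' * inner ℝ g z :=
    mul_le_mul_of_nonneg_left (neg_le_of_abs_le (abs_real_inner_le_norm g z)) (by positivity)
  have e5 : 1 / l * v ≤ 1 / l * p := mul_le_mul_of_nonneg_left hvp (by positivity)
  rw [inner_sub_right] at e1
  rw [hk] at e3
  rw [hk]
  linarith

theorem isClosed_epi {g : Rn n → EReal} (hg : LowerSemicontinuous g) : IsClosed (epi g) :=
  hg.isClosed_epigraph.preimage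
    (f := fun p : Rn n × ℝ => (p.1, (p.2 : EReal)))
    (continuous_fst.prodMk (continuous_coe_real_ereal.comp continuous_snd))

theorem lowerSemicontinuous_shift (hφ : IsGammaZero φ) (hf : IsProper f)
    (hlsc : LowerSemicontinuous f) {l : ℝ} (hl : 0 < l) : LowerSemicontinuous (shift φ l f) := by
  have hl' : 0 < 1 / l := one_div_pos.mpr hl
  refine hlsc.add' ?_ fun x => EReal.continuousAt_add
    (Or.inr (coe_mul_ne_bot hl'.le (hφ.proper.1 x))) (Or.inl (hf.1 x))
  intro x c hc
  have key : ∀ e : EReal, c < ((1 / l : ℝ) : EReal) * e ↔ c / ((1 / l : ℝ) : EReal) < e := fun e => by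
    rw [EReal.div_lt_iff (by exact_mod_cast hl') (EReal.coe_ne_top _), mul_comm]
  simp only [key] at hc ⊢
  exact hφ.lsc x _ hc

end Shift

end BregmanAvg

namespace BregmanAvg

variable {n : ℕ} {φ f₁ f₂ : Rn n → EReal} {α : ℝ}

/-! ### The infimum of affine functions of t = 1/λ -/

section Values

theorem upSub_coe_lt_iff {a c : EReal} {w : ℝ} : upSub a w < c ↔ a < c + w := by
  rw [upSub, upAdd]
  split_ifs with h
  · rcases h with rfl | h
    · simp
    · rw [← EReal.coe_neg] at h
      exact absurd h (EReal.coe_ne_top _)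
  · rw [← sub_eq_add_neg]
    exact EReal.sub_lt_iff (Or.inl (EReal.coe_ne_bot _)) (Or.inl (EReal.coe_ne_top _))

theorem upSub_top (a : EReal) : upSub ⊤ a = ⊤ := by simp [upSub, upAdd]

theorem le_of_mem_avgSet_liftEpi (hφ : Convex ℝ (epi φ)) (hα : α ∈ Set.Icc (0 : ℝ) 1) {x : Rn n}
    {s p : ℝ} (h : (x, s, p) ∈ avgSet α (liftEpi φ f₁) (liftEpi φ f₂)) : φ x ≤ p := by
  have hC : Convex ℝ {q : Rn n × ℝ × ℝ | φ q.1 ≤ q.2.2} :=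
    fun q hq q' hq' a b ha hb hab =>
      hφ (x := (q.1, q.2.2)) hq (y := (q'.1, q'.2.2)) hq' ha hb hab
  exact avgSet_subset hα (fun q hq => hq.2) (fun q hq => hq.2) hC h

/-- Two functions `g₁, g₂` whose epigraphs are images of the lifted epigraphs have an epi-average
that is described by the average of the lifted epigraphs. -/
theorem exists_mem_avgSet_iff {t : ℝ} {g₁ g₂ : Rn n → EReal}
    (h₁ : epi g₁ = tilt t '' liftEpi φ f₁) (h₂ : epi g₂ = tilt t '' liftEpi φ f₂) {x : Rn n}
    {c : EReal} : (∃ r : ℝ, (r : EReal) < c ∧ (x, r) ∈ avgSet α (epi g₁) (epi g₂)) ↔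
      ∃ s p : ℝ, (x, s, p) ∈ avgSet α (liftEpi φ f₁) (liftEpi φ f₂) ∧
        ((s + t * p : ℝ) : EReal) < c := by
  rw [h₁, h₂, avgSet_image]
  constructor
  · rintro ⟨r, hr, ⟨⟨z, s, p⟩, hq, h⟩⟩
    obtain ⟨rfl, rfl⟩ := Prod.mk.inj h
    exact ⟨s, p, hq, hr⟩
  · rintro ⟨s, p, hq, h⟩
    exact ⟨_, h, _, hq, rfl⟩

/-- The function `[(α ⋆ conv g₁) □ ((1 - α) ⋆ conv g₂)] - t φ` for `gᵢ = fᵢ + t φ`, written in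
terms of the average of the lifted epigraphs. -/
noncomputable def tiltedAvg (φ f₁ f₂ : Rn n → EReal) (α t : ℝ) (x : Rn n) : EReal :=
  ⨅ q ∈ {q : ℝ × ℝ | (x, q) ∈ avgSet α (liftEpi φ f₁) (liftEpi φ f₂)},
    ((q.1 + t * (q.2 - realVal φ x) : ℝ) : EReal)

theorem tiltedAvg_lt_iff {t : ℝ} {x : Rn n} {c : EReal} :
    tiltedAvg φ f₁ f₂ α t x < c ↔ ∃ s p : ℝ,
      (x, s, p) ∈ avgSet α (liftEpi φ f₁) (liftEpi φ f₂) ∧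
        ((s + t * (p - realVal φ x) : ℝ) : EReal) < c := by
  simp only [tiltedAvg, iInf_lt_iff, Set.mem_ofPred_eq, Prod.exists, exists_prop]

theorem realVal_le_of_mem_avgSet (hφ : IsGammaZero φ) (hα : α ∈ Set.Icc (0 : ℝ) 1) {x : Rn n}
    {s p : ℝ} (h : (x, s, p) ∈ avgSet α (liftEpi φ f₁) (liftEpi φ f₂)) :
    φ x = realVal φ x ∧ realVal φ x ≤ p := by
  obtain ⟨v, hv, hvp⟩ := hφ.proper.exists_coe_eq (le_of_mem_avgSet_liftEpi hφ.convex hα h)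
  rw [realVal_eq hv]
  exact ⟨hv, hvp⟩

theorem tiltedAvg_mono (hφ : IsGammaZero φ) (hα : α ∈ Set.Icc (0 : ℝ) 1) (x : Rn n) :
    Monotone fun t => tiltedAvg φ f₁ f₂ α t x := by
  intro t t' htt'
  refine le_of_forall_gt fun c hc => ?_
  obtain ⟨s, p, h, hlt⟩ := tiltedAvg_lt_iff.mp hc
  refine tiltedAvg_lt_iff.mpr ⟨s, p, h, lt_of_le_of_lt (EReal.coe_le_coe_iff.mpr ?_) hlt⟩
  have := mul_le_mul_of_nonneg_right htt' (sub_nonneg.mpr (realVal_le_of_mem_avgSet hφ hα h).2)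
  linarith

/-- An infimum of continuous functions of t is upper semicontinuous; monotonicity supplies the
opposite bound, but only from the right. -/
theorem tiltedAvg_tendsto (hφ : IsGammaZero φ) (hα : α ∈ Set.Icc (0 : ℝ) 1) (x : Rn n) (t : ℝ) :
    Tendsto (fun t => tiltedAvg φ f₁ f₂ α t x) (𝓝[≥] t) (𝓝 (tiltedAvg φ f₁ f₂ α t x)) := by
  refine tendsto_order.mpr ⟨fun c hc => ?_, fun c hc => ?_⟩
  · filter_upwards [self_mem_nhdsWithin] with t' ht'
    exact hc.trans_le (tiltedAvg_mono hφ hα x ht')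
  · obtain ⟨s, p, h, hlt⟩ := tiltedAvg_lt_iff.mp hc
    have hcont : Continuous fun t' : ℝ => ((s + t' * (p - realVal φ x) : ℝ) : EReal) :=
      continuous_coe_real_ereal.comp (by fun_prop)
    have := hcont.continuousAt.eventually (gt_mem_nhds hlt)
    filter_upwards [nhdsWithin_le_nhds this] with t' ht'
    exact tiltedAvg_lt_iff.mpr ⟨s, p, h, ht'⟩

theorem tiltedAvg_eq_top (hφ : IsGammaZero φ) (hα : α ∈ Set.Icc (0 : ℝ) 1) {x : Rn n}
    (hx : x ∉ effDom φ) (t : ℝ) : tiltedAvg φ f₁ f₂ α t x = ⊤ := by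
  by_contra h
  obtain ⟨s, p, h, -⟩ := tiltedAvg_lt_iff.mp (lt_top_iff_ne_top.mpr h)
  exact hx ((le_of_mem_avgSet_liftEpi hφ.convex hα h).trans_lt (EReal.coe_lt_top p))

/-- A function with the sublevel description of an epi-average, minus `t φ`, is `tiltedAvg`. -/
theorem upSub_eq_tiltedAvg (hφ : IsGammaZero φ) (hα : α ∈ Set.Icc (0 : ℝ) 1) {t : ℝ} {x : Rn n}
    {h : EReal} (hh : ∀ c : EReal, h < c ↔ ∃ s p : ℝ,
      (x, s, p) ∈ avgSet α (liftEpi φ f₁) (liftEpi φ f₂) ∧ ((s + t * p : ℝ) : EReal) < c) :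
    upSub h ((t : EReal) * φ x) = tiltedAvg φ f₁ f₂ α t x := by
  by_cases hx : x ∈ effDom φ
  · refine eq_of_forall_gt_iff fun c => ?_
    rw [hφ.proper.coe_realVal hx, ← EReal.coe_mul, upSub_coe_lt_iff, hh, tiltedAvg_lt_iff]
    refine exists₂_congr fun s p => and_congr_right fun _ => ?_
    rw [show s + t * (p - realVal φ x) = s + t * p - t * realVal φ x by ring, EReal.coe_sub,
      EReal.sub_lt_iff (Or.inl (EReal.coe_ne_bot _)) (Or.inl (EReal.coe_ne_top _))]
  · have htop : h = ⊤ := by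
      by_contra hne
      obtain ⟨s, p, hmem, -⟩ := (hh ⊤).mp (lt_top_iff_ne_top.mpr hne)
      exact hx ((le_of_mem_avgSet_liftEpi hφ.convex hα hmem).trans_lt (EReal.coe_lt_top p))
    rw [htop, upSub_top, tiltedAvg_eq_top hφ hα hx]

end Values

/-! ### The proximal average and the limit functions as tilted averages -/

section Representation

theorem epi_shift_nonempty (hφ : IsProper φ) {f : Rn n → EReal} (hf : IsProper f)
    (hd : (effDom f ∩ effDom φ).Nonempty) {l : ℝ} (hl : 0 < l) : (epi (shift φ l f)).Nonempty := by
  rw [epi_shift hφ hf hl]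
  exact (liftEpi_nonempty hφ hf hd).image _

theorem upSub_epiAvg_shift (hφ : IsGammaZero φ) (hf₁ : IsProper f₁) (hf₂ : IsProper f₂)
    (hd₁ : (effDom f₁ ∩ effDom φ).Nonempty) (hd₂ : (effDom f₂ ∩ effDom φ).Nonempty)
    (hα : α ∈ Set.Icc (0 : ℝ) 1) {l : ℝ} (hl : 0 < l) (x : Rn n) :
    upSub (epiAvg α (convFn (shift φ l f₁)) (convFn (shift φ l f₂)) x)
      (((1 / l : ℝ) : EReal) * φ x) = tiltedAvg φ f₁ f₂ α (1 / l) x :=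
  upSub_eq_tiltedAvg hφ hα fun c => by
    rw [epiAvg_convFn_lt_iff (epi_shift_nonempty hφ.proper hf₁ hd₁ hl)
      (epi_shift_nonempty hφ.proper hf₂ hd₂ hl) hα, exists_mem_avgSet_iff
      (epi_shift hφ.proper hf₁ hl) (epi_shift hφ.proper hf₂ hl)]

theorem epiAvg_add_indic (hφ : IsGammaZero φ) (hf₁ : IsProper f₁) (hf₂ : IsProper f₂)
    (hd₁ : (effDom f₁ ∩ effDom φ).Nonempty) (hd₂ : (effDom f₂ ∩ effDom φ).Nonempty)
    (hα : α ∈ Set.Icc (0 : ℝ) 1) (x : Rn n) :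
    epiAvg α (convFn (fun z => f₁ z + indic (effDom φ) z))
      (convFn (fun z => f₂ z + indic (effDom φ) z)) x = tiltedAvg φ f₁ f₂ α 0 x := by
  refine eq_of_forall_gt_iff fun c => ?_
  rw [epiAvg_convFn_lt_iff _ _ hα, exists_mem_avgSet_iff (epi_add_indic hφ.proper hf₁)
    (epi_add_indic hφ.proper hf₂), tiltedAvg_lt_iff]
  · simp only [zero_mul]
  · rw [epi_add_indic hφ.proper hf₁]
    exact (liftEpi_nonempty hφ.proper hf₁ hd₁).image _
  · rw [epi_add_indic hφ.proper hf₂]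
    exact (liftEpi_nonempty hφ.proper hf₂ hd₂).image _

/-- The proximal average in terms of the average of the lifted epigraphs. -/
theorem proxAvg_eq_tiltedAvg (hφ : IsKernel φ) (hf₁ : IsProper f₁) (hf₂ : IsProper f₂)
    (hlsc₁ : LowerSemicontinuous f₁) (hlsc₂ : LowerSemicontinuous f₂)
    (hd₁ : (effDom f₁ ∩ effDom φ).Nonempty) (hd₂ : (effDom f₂ ∩ effDom φ).Nonempty)
    (hα : α ∈ Set.Icc (0 : ℝ) 1) {l : ℝ} (hl : 0 < l)
    (hlt : (l : EReal) < min (proxThreshold φ f₁) (proxThreshold φ f₂)) (x : Rn n) :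
    proxAvg φ f₁ f₂ α l x = tiltedAvg φ f₁ f₂ α (1 / l) x := by
  have hΓ := hφ.legendre.gammaZero
  refine upSub_eq_tiltedAvg hΓ hα fun c => ?_
  rw [conj_arithAvg_conj_lt_iff (isClosed_epi (lowerSemicontinuous_shift hΓ hf₁ hlsc₁ hl))
    (isClosed_epi (lowerSemicontinuous_shift hΓ hf₂ hlsc₂ hl))
    (superlinear_epi_shift hφ hf₁ hl (lt_min_iff.mp hlt).1)
    (superlinear_epi_shift hφ hf₂ hl (lt_min_iff.mp hlt).2)
    (epi_shift_nonempty hΓ.proper hf₁ hd₁ hl) (epi_shift_nonempty hΓ.proper hf₂ hd₂ hl) hα,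
    exists_mem_avgSet_iff (epi_shift hΓ.proper hf₁ hl) (epi_shift hΓ.proper hf₂ hl)]

end Representation

/-! ### Epi-limits of sequences bounded below by their pointwise limit -/

section EpiLimit

theorem frequently_lt_of_clFn_lt {p : Rn n → EReal} {x : Rn n} {c : EReal} (h : clFn p x < c) :
    ∃ᶠ z in 𝓝 x, p z < c := frequently_lt_of_liminf_lt (by isBoundedDefault) h

/-- A sequence of functions bounded below by `p` and converging pointwise to `p` epi-converges to
the lower semicontinuous hull of `p`. -/
theorem epiConvergesAt_clFn {F : ℕ → Rn n → EReal} {p : Rn n → EReal} {x : Rn n}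
    (hle : ∀ᶠ k in atTop, ∀ z, p z ≤ F k z)
    (hlim : ∀ z, Tendsto (fun k => F k z) atTop (𝓝 (p z))) :
    EpiConvergesAt F (clFn p) x := by
  have hlow : ∀ u : ℕ → Rn n, Tendsto u atTop (𝓝 x) →
      clFn p x ≤ liminf (fun k => F k (u k)) atTop := by
    intro u hu
    refine le_trans ?_ (liminf_le_liminf (u := fun k => p (u k)) (hle.mono fun k hk => hk _))
    rw [show (fun k => p (u k)) = p ∘ u from rfl, liminf_comp]
    exact liminf_le_liminf_of_le hu
  refine ⟨hlow, ?_⟩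
  rcases eq_or_ne (clFn p x) ⊤ with htop | htop
  · refine ⟨fun _ => x, tendsto_const_nhds, ?_⟩
    exact tendsto_of_le_liminf_of_limsup_le (hlow _ tendsto_const_nhds) (by rw [htop]; exact le_top)
  obtain ⟨c, -, hc, hclim⟩ := exists_seq_strictAnti_tendsto' (lt_top_iff_ne_top.mpr htop)
  have hz : ∀ m : ℕ, ∃ z ∈ Metric.ball x (1 / ((m : ℝ) + 1)), p z < c m := fun m =>
    (((frequently_lt_of_clFn_lt (hc m).1).and_eventually
      (Metric.ball_mem_nhds x Nat.one_div_pos_of_nat)).exists).imp fun z hz => ⟨hz.2, hz.1⟩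
  choose z hzx hzc using hz
  have hzlim : Tendsto z atTop (𝓝 x) := by
    rw [tendsto_iff_dist_tendsto_zero]
    exact squeeze_zero (fun _ => dist_nonneg) (fun m => (hzx m).le)
      tendsto_one_div_add_atTop_nhds_zero_nat
  have hev : ∀ m, ∀ᶠ k in atTop, F k (z m) < c m := fun m =>
    (hlim (z m)).eventually (gt_mem_nhds (hzc m))
  classical
  -- Diagonal choice: the furthest approximating point already controlled at stage k. When no index
  -- qualifies the value is 0, so `hmc` needs index 0 to be eventually valid.
  let m : ℕ → ℕ := fun k => Nat.findGreatest (fun j => F k (z j) < c j) k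
  have hm : Tendsto m atTop atTop := tendsto_atTop.mpr fun M => by
    filter_upwards [hev M, eventually_ge_atTop M] with k hk hMk
    exact Nat.le_findGreatest hMk hk
  have hmc : ∀ᶠ k in atTop, F k (z (m k)) < c (m k) := by
    filter_upwards [hev 0] with k hk
    exact Nat.findGreatest_spec (P := fun j => F k (z j) < c j) (Nat.zero_le k) hk
  refine ⟨z ∘ m, hzlim.comp hm, ?_⟩
  refine tendsto_of_le_liminf_of_limsup_le (hlow _ (hzlim.comp hm)) ?_
  calc limsup (fun k => F k ((z ∘ m) k)) atTop ≤ limsup (c ∘ m) atTop :=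
        limsup_le_limsup (hmc.mono fun k hk => hk.le)
    _ = clFn p x := (hclim.comp hm).limsup_eq

end EpiLimit

end BregmanAvg

namespace BregmanAvg

variable {n : ℕ} {φ f f₁ f₂ : Rn n → EReal} {α : ℝ}

/-! ### Growth of the Bregman distance and limits of envelopes -/

section Growth

theorem IsKernel.convex_intDom (hφ : IsKernel φ) : Convex ℝ (intDom φ) :=
  hφ.legendre.gammaZero.convexOn.1.interior

theorem IsKernel.intDom_subset_domSubdiff (hφ : IsKernel φ) : intDom φ ⊆ domSubdiff φ := by
  intro x hx
  refine ⟨intDom_subset hx, gradient (realVal φ) x, fun y => ?_⟩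
  rw [hφ.legendre.gammaZero.proper.coe_realVal (intDom_subset hx), ← EReal.coe_add]
  by_cases hy : y ∈ effDom φ
  · have hv := hφ.legendre.gammaZero.proper.coe_realVal hy
    rw [hv]
    exact_mod_cast hφ.gradient_le hx hv
  · rw [effDom, Set.mem_ofPred_eq, not_lt_top_iff] at hy
    rw [hy]
    exact le_top

/-- At the midpoint of x and z, strict convexity gives a strict upper bound on φ and the gradient
inequality at x a lower one. -/
theorem IsKernel.gradient_lt (hφ : IsKernel φ) {x z : Rn n} (hx : x ∈ intDom φ)
    (hz : z ∈ intDom φ) (hne : z ≠ x) :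
    0 < realVal φ z - realVal φ x - inner ℝ (gradient (realVal φ) x) (z - x) := by
  have hp := hφ.legendre.gammaZero.proper
  have hs := (hφ.legendre.strict _ hφ.intDom_subset_domSubdiff hφ.convex_intDom).2 hz hx hne
    (half_pos one_pos) (half_pos one_pos) (add_halves 1)
  have hmem : (1 / 2 : ℝ) • z + (1 / 2 : ℝ) • x ∈ intDom φ :=
    hφ.convex_intDom hz hx (by norm_num) (by norm_num) (by norm_num)
  have hg := hφ.gradient_le hx (hp.coe_realVal (intDom_subset hmem))
  have e : (1 / 2 : ℝ) • z + (1 / 2 : ℝ) • x - x = (1 / 2 : ℝ) • (z - x) := by module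
  rw [e, inner_smul_right] at hg
  simp only [smul_eq_mul] at hs
  linarith

/-- The Bregman distance to a point of the interior grows at least linearly away from it. -/
theorem IsKernel.exists_growth (hφ : IsKernel φ) {x : Rn n} (hx : x ∈ intDom φ) {ε : ℝ}
    (hε : 0 < ε) : ∃ δ : ℝ, 0 < δ ∧ ∀ (z : Rn n) (v : ℝ), φ z = v → ε ≤ ‖z - x‖ →
      δ * ‖z - x‖ ≤ v - realVal φ x - inner ℝ (gradient (realVal φ) x) (z - x) := by
  have hΓ := hφ.legendre.gammaZero
  set g := gradient (realVal φ) x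
  obtain ⟨ρ, hρ, hball⟩ := Metric.nhds_basis_closedBall.mem_iff.mp (isOpen_interior.mem_nhds hx)
  set r := min ε ρ
  have hr : 0 < r := lt_min hε hρ
  have hsub : Metric.sphere x r ⊆ intDom φ :=
    Metric.sphere_subset_closedBall.trans
      ((Metric.closedBall_subset_closedBall (min_le_right _ _)).trans hball)
  have hcont : ContinuousOn (fun z => realVal φ z - realVal φ x - inner ℝ g (z - x))
      (Metric.sphere x r) := by
    have h1 : ContinuousOn (realVal φ) (Metric.sphere x r) := fun z hz =>
      (hφ.legendre.smooth.differentiableAt z (hsub hz)).continuousAt.continuousWithinAt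
    exact (h1.sub continuousOn_const).sub (by fun_prop)
  obtain ⟨m, hm, hmin⟩ := (isCompact_sphere x r).exists_forall_le' hcont (a := 0) fun z hz =>
    hφ.gradient_lt hx (hsub hz) (ne_of_mem_of_not_mem hz (by simp [hr.ne]))
  refine ⟨m / r, div_pos hm hr, fun z v hv hz => ?_⟩
  have hz0 : 0 < ‖z - x‖ := hε.trans_le hz
  -- This factor pulls z back along the segment to the sphere of radius r, where the distance is at
  -- least m; by convexity the distance at z is at least m/θ.
  set θ := r / ‖z - x‖
  have hθ : 0 < θ := div_pos hr hz0
  have hθ1 : θ ≤ 1 := (div_le_one hz0).mpr ((min_le_left _ _).trans hz)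
  have hzd : z ∈ effDom φ := by
    rw [effDom, Set.mem_ofPred_eq, hv]
    exact EReal.coe_lt_top v
  have e : θ • z + (1 - θ) • x - x = θ • (z - x) := by module
  have h1 := hmin (θ • z + (1 - θ) • x) (by
    rw [mem_sphere_iff_norm, e, norm_smul, Real.norm_of_nonneg hθ.le]
    exact div_mul_cancel₀ r hz0.ne')
  have h2 := hΓ.convexOn.2 hzd (intDom_subset hx) hθ.le (sub_nonneg.mpr hθ1) (by ring)
  rw [e, inner_smul_right] at h1
  simp only [smul_eq_mul, realVal_eq hv] at h2
  have h3 : m ≤ θ * (v - realVal φ x - inner ℝ g (z - x)) := by linarith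
  calc m / r * ‖z - x‖ = m / θ := by simp only [θ]; field_simp
    _ ≤ _ := by rw [div_le_iff₀ hθ]; linarith

/-- Convergence of the Bregman envelope from below, as the parameter decreases to `0`. -/
theorem eventually_le_breg (hφ : IsKernel φ) (hlsc : LowerSemicontinuous f)
    (hpb : 0 < proxThreshold φ f) {x : Rn n} (hx : x ∈ intDom φ) {a : ℝ} (ha : (a : EReal) < f x) :
    ∀ᶠ l : ℝ in 𝓝[>] 0, ∀ (z : Rn n) (s v : ℝ), f z ≤ s → φ z = v →
      a ≤ s + 1 / l * (v - realVal φ x - inner ℝ (gradient (realVal φ) x) (z - x)) := by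
  obtain ⟨ε, hε, hball⟩ := Metric.eventually_nhds_iff.mp (hlsc x _ ha)
  obtain ⟨δ, hδ, hgrow⟩ := hφ.exists_growth hx hε
  obtain ⟨l', -, hl', y, hy, c, hc⟩ := exists_breg_bound (l := 0) hφ hpb
  set g := gradient (realVal φ) x
  set g' := gradient (realVal φ) y
  -- A, the Bregman distance from x to y, and G, the weighted gradient gap, measure the change of
  -- base point from y to x. B/ε absorbs the constant terms where ‖z − x‖ ≥ ε, and dividing by the
  -- growth rate δ shows how large 1/l has to be.
  set A := realVal φ x - realVal φ y - inner ℝ g' (x - y) with hA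
  set B := |a - c + 1 / l' * A|
  set G := 1 / l' * ‖g - g'‖
  have hlim : ∀ᶠ l : ℝ in 𝓝[>] 0, 1 / l' + (G + B / ε) / δ ≤ 1 / l := by
    simp only [one_div]
    exact tendsto_inv_nhdsGT_zero.eventually_ge_atTop _
  filter_upwards [hlim, self_mem_nhdsWithin] with l hl hl0 z s v hs hv
  have hl0 : 0 < l := hl0
  have hD := hφ.gradient_le hx hv
  rcases lt_or_ge ‖z - x‖ ε with hz | hz
  · have h1 : (a : EReal) < s := (hball (by rwa [dist_eq_norm])).trans_le hs
    have h1 : a < s := by exact_mod_cast h1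
    have := mul_nonneg (one_div_pos.mpr hl0).le
      (show 0 ≤ v - realVal φ x - inner ℝ g (z - x) by linarith)
    linarith
  · have h1 := hc z s v hs hv
    have h2 := hgrow z v hv hz
    set D := v - realVal φ x - inner ℝ g (z - x) with hDdef
    -- The three-point identity for Bregman distances.
    have h3 : v - realVal φ y - inner ℝ g' (z - y) = D + A + inner ℝ (g - g') (z - x) := by
      simp only [hDdef, hA, inner_sub_left, inner_sub_right]
      ring
    have h4 : 1 / l' * inner ℝ (g - g') (z - x) ≤ G * ‖z - x‖ := by
      rw [mul_assoc]
      exact mul_le_mul_of_nonneg_left (real_inner_le_norm _ _) (one_div_pos.mpr hl').le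
    have hk : G + B / ε ≤ (1 / l - 1 / l') * δ := by
      rw [← div_le_iff₀ hδ]; linarith
    have hk0 : 0 ≤ 1 / l - 1 / l' := by
      have : 0 ≤ (G + B / ε) / δ := by positivity
      linarith
    have h5 : (G + B / ε) * ‖z - x‖ ≤ (1 / l - 1 / l') * D :=
      calc (G + B / ε) * ‖z - x‖ ≤ (1 / l - 1 / l') * δ * ‖z - x‖ :=
            mul_le_mul_of_nonneg_right hk (norm_nonneg _)
        _ ≤ (1 / l - 1 / l') * D := by
            rw [mul_assoc]
            exact mul_le_mul_of_nonneg_left h2 hk0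
    have h6 : B ≤ B / ε * ‖z - x‖ := by
      rw [div_mul_eq_mul_div, le_div_iff₀ hε]
      exact mul_le_mul_of_nonneg_left hz (abs_nonneg _)
    have h7 : a - c + 1 / l' * A ≤ B := le_abs_self _
    rw [h3] at h1
    linarith

end Growth

/-! ### Bounds and semicontinuity for small λ -/

section SmallParameter

theorem coe_le_upSub_coe_iff {a : EReal} {c w : ℝ} :
    (c : EReal) ≤ upSub a w ↔ ((c + w : ℝ) : EReal) ≤ a := by
  rw [← not_lt, upSub_coe_lt_iff, not_lt, EReal.coe_add]

/-- Lower bound of the proximal average by an average of Bregman envelopes. -/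
theorem le_proxAvg (hφ : IsKernel φ) (hf₁ : IsProper f₁) (hf₂ : IsProper f₂)
    (hα : α ∈ Set.Icc (0 : ℝ) 1) {l : ℝ} (hl : 0 < l) {x : Rn n} (hx : x ∈ intDom φ) {a b : ℝ}
    (ha : ∀ (z : Rn n) (s v : ℝ), f₁ z ≤ s → φ z = v →
      a ≤ s + 1 / l * (v - realVal φ x - inner ℝ (gradient (realVal φ) x) (z - x)))
    (hb : ∀ (z : Rn n) (s v : ℝ), f₂ z ≤ s → φ z = v →
      b ≤ s + 1 / l * (v - realVal φ x - inner ℝ (gradient (realVal φ) x) (z - x))) :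
    ((α * a + (1 - α) * b : ℝ) : EReal) ≤ proxAvg φ f₁ f₂ α l x := by
  have hp := hφ.legendre.gammaZero.proper
  set g := gradient (realVal φ) x
  have key : ∀ {f : Rn n → EReal} {a : ℝ}, IsProper f → (∀ (z : Rn n) (s v : ℝ), f z ≤ s →
      φ z = v → a ≤ s + 1 / l * (v - realVal φ x - inner ℝ g (z - x))) →
      -- At the slope ∇φ(x)/l, the function f + φ/l minus its linear term is f plus the Bregman
      -- distance to x over l, up to a constant.
      conj (shift φ l f) ((1 / l) • g) ≤
        ((inner ℝ ((1 / l) • g) x - 1 / l * realVal φ x - a : ℝ) : EReal) := by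
    intro f a hf h
    rw [conj_le_coe_iff, epi_shift hp hf hl]
    rintro _ ⟨⟨z, s, p⟩, ⟨h1, h2⟩, rfl⟩
    obtain ⟨v, hv, hvp⟩ := hp.exists_coe_eq h2
    have h3 := h z s v h1 hv
    have h4 := mul_le_mul_of_nonneg_left hvp (one_div_pos.mpr hl).le
    simp only [tilt_apply, inner_smul_left, conj_trivial] at *
    rw [inner_sub_right] at h3
    linarith
  rw [proxAvg, hp.coe_realVal (intDom_subset hx), ← EReal.coe_mul, coe_le_upSub_coe_iff]
  refine le_trans (EReal.coe_le_coe_iff.mpr ?_) (le_conj_arithAvg_conj hα (key hf₁ ha) (key hf₂ hb) x)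
  linarith

/-- Averaging points over the same x gives a competitor with p = φ(x), so the term in t vanishes. -/
theorem tiltedAvg_le_arithAvg (hφ : IsProper φ) (hf₁ : IsProper f₁) (hf₂ : IsProper f₂)
    (hd₁ : (effDom f₁ ∩ effDom φ).Nonempty) (hd₂ : (effDom f₂ ∩ effDom φ).Nonempty)
    (hα : α ∈ Set.Icc (0 : ℝ) 1) {x : Rn n} (hx : x ∈ effDom φ) (t : ℝ) :
    tiltedAvg φ f₁ f₂ α t x ≤ arithAvg α f₁ f₂ x := by
  refine le_of_forall_gt fun c hc => ?_
  obtain ⟨a, b, ha, hb, hlt⟩ := exists_real_of_wsum_lt hα.1 (sub_nonneg.mpr hα.2) (hf₁.1 x)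
    (hf₂.1 x) hc
  have hv := (hφ.coe_realVal hx).le
  have hmem := smul_add_smul_mem_avgSet (liftEpi_nonempty hφ hf₁ hd₁)
    (liftEpi_nonempty hφ hf₂ hd₂) (a := (x, a, realVal φ x)) (b := (x, b, realVal φ x))
    (ha.imp_right fun h => ⟨h, hv⟩) (hb.imp_right fun h => ⟨h, hv⟩)
  have e : α • (x, a, realVal φ x) + (1 - α) • (x, b, realVal φ x) =
      (x, α * a + (1 - α) * b, realVal φ x) := by
    simp only [Prod.smul_mk, Prod.mk_add_mk, smul_eq_mul, ← add_smul, ← add_mul,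
      add_sub_cancel, one_smul, one_mul]
  rw [e] at hmem
  exact tiltedAvg_lt_iff.mpr ⟨_, _, hmem, by simpa using hlt⟩

theorem lowerSemicontinuous_conj (g : Rn n → EReal) : LowerSemicontinuous (conj g) := by
  refine lowerSemicontinuous_iSup fun y => ?_
  generalize g y = e
  induction e with
  | top => simp only [EReal.sub_top]; exact lowerSemicontinuous_const
  | bot => simp only [EReal.coe_sub_bot]; exact lowerSemicontinuous_const
  | coe e =>
    simp only [← EReal.coe_sub]
    exact (continuous_coe_real_ereal.comp (by fun_prop)).lowerSemicontinuous

/-- A lower semicontinuous function minus a positive multiple of `φ` is lower semicontinuous,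
provided that the difference is `+∞` outside the domain of `φ`. -/
theorem lowerSemicontinuous_upSub (hφ : IsKernel φ) {h : Rn n → EReal}
    (hlsc : LowerSemicontinuous h) {t : ℝ} (ht : 0 < t)
    (htop : ∀ z ∉ effDom φ, upSub (h z) ((t : EReal) * φ z) = ⊤) :
    LowerSemicontinuous fun x => upSub (h x) ((t : EReal) * φ x) := by
  have hp := hφ.legendre.gammaZero.proper
  intro x c hc
  beta_reduce at hc ⊢
  by_cases hx : x ∈ effDom φ
  -- The gap c₂ < c₃ is spent on the lower semicontinuity of h, and the gap c₁ < c₂ on the relative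
  -- continuity of φ.
  · obtain ⟨c₁, hc₁, hc₁'⟩ := EReal.lt_iff_exists_real_btwn.mp hc
    obtain ⟨c₂, hc₂, hc₂'⟩ := EReal.lt_iff_exists_real_btwn.mp hc₁'
    obtain ⟨c₃, hc₃, hc₃'⟩ := EReal.lt_iff_exists_real_btwn.mp hc₂'
    have hc₂ : c₁ < c₂ := by exact_mod_cast hc₂
    have hc₃ : c₂ < c₃ := by exact_mod_cast hc₃
    have hle := hc₃'.le
    rw [hp.coe_realVal hx, ← EReal.coe_mul, coe_le_upSub_coe_iff] at hle
    have h1 := hlsc x ((c₂ + t * realVal φ x : ℝ) : EReal)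
      ((EReal.coe_lt_coe_iff.mpr (by linarith)).trans_le hle)
    have h2 : ∀ᶠ z in 𝓝[effDom φ] x, φ z < ((realVal φ x + (c₂ - c₁) / t : ℝ) : EReal) := by
      refine (hφ.continuousOn x hx).eventually (gt_mem_nhds ?_)
      rw [hp.coe_realVal hx, EReal.coe_lt_coe_iff]
      linarith [div_pos (sub_pos.mpr hc₂) ht]
    filter_upwards [h1, eventually_nhdsWithin_iff.mp h2] with z hz1 hz2
    by_cases hz : z ∈ effDom φ
    · refine hc₁.trans_le ?_
      have hz2 := hz2 hz
      rw [hp.coe_realVal hz, EReal.coe_lt_coe_iff] at hz2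
      rw [hp.coe_realVal hz, ← EReal.coe_mul, coe_le_upSub_coe_iff]
      refine le_trans (EReal.coe_le_coe_iff.mpr ?_) hz1.le
      have h3 := mul_le_mul_of_nonneg_left hz2.le ht.le
      rw [mul_add, mul_div_cancel₀ _ ht.ne'] at h3
      linarith
    · rw [htop z hz]
      exact hc₁.trans (EReal.coe_lt_top _)
  · filter_upwards [hφ.closed_dom.isOpen_compl.mem_nhds hx] with z hz
    rw [htop z hz]
    exact lt_of_lt_of_le hc le_top

/-- If `f₁` and `f₂` have their domains in the interior of the domain of `φ`, then so does the
proximal average. -/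
theorem tiltedAvg_eq_top_of_subset (hφ : IsKernel φ) (hα : α ∈ Set.Icc (0 : ℝ) 1)
    (h₁ : effDom f₁ ⊆ intDom φ) (h₂ : effDom f₂ ⊆ intDom φ) {x : Rn n} (hx : x ∉ intDom φ)
    (t : ℝ) : tiltedAvg φ f₁ f₂ α t x = ⊤ := by
  by_contra h
  obtain ⟨s, p, h, -⟩ := tiltedAvg_lt_iff.mp (lt_top_iff_ne_top.mpr h)
  have hC : Convex ℝ {q : Rn n × ℝ × ℝ | q.1 ∈ intDom φ} :=
    hφ.convex_intDom.linear_preimage (LinearMap.fst ℝ (Rn n) (ℝ × ℝ))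
  exact hx (avgSet_subset (C := {q : Rn n × ℝ × ℝ | q.1 ∈ intDom φ}) hα (fun q hq => h₁ (hq.1.trans_lt (EReal.coe_lt_top _)))
    (fun q hq => h₂ (hq.1.trans_lt (EReal.coe_lt_top _))) hC h)

theorem arithAvg_eq_top (hα : α ∈ Set.Icc (0 : ℝ) 1) {x : Rn n} (h₁ : f₁ x = ⊤) (h₂ : f₂ x = ⊤) :
    arithAvg α f₁ f₂ x = ⊤ := by
  rw [arithAvg, h₁, h₂]
  rcases hα.1.eq_or_lt with rfl | h0
  · simp
  · rw [EReal.coe_mul_top_of_pos h0,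
      EReal.top_add_of_ne_bot (coe_mul_ne_bot (sub_nonneg.mpr hα.2) top_ne_bot)]

end SmallParameter

end BregmanAvg

/-! ### The main theorem -/

theorem theorem6p4 {n : ℕ} (φ f₁ f₂ : Rn n → EReal) (α : ℝ) (lbar : EReal)
    (hφ : IsKernel φ)
    (hf₁ : IsProper f₁) (hf₂ : IsProper f₂)
    (hf₁_lsc : LowerSemicontinuous f₁) (hf₂_lsc : LowerSemicontinuous f₂)
    (hf₁_pb : 0 < proxThreshold φ f₁) (hf₂_pb : 0 < proxThreshold φ f₂)
    (hlbar : lbar = min (proxThreshold φ f₁) (proxThreshold φ f₂))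
    (hf₁_dom : (effDom f₁ ∩ effDom φ).Nonempty) (hf₂_dom : (effDom f₂ ∩ effDom φ).Nonempty)
    (hα : α ∈ Set.Icc (0 : ℝ) 1) :
    (∀ x, AntitoneOn (fun l : ℝ => proxAvg φ f₁ f₂ α l x)
      {l : ℝ | 0 < l ∧ (l : EReal) < lbar}) ∧
    (∀ L : ℝ, (L : EReal) = lbar → ∀ x,
      Tendsto (fun l : ℝ => proxAvg φ f₁ f₂ α l x) (𝓝[<] L)
        (𝓝 (upSub (epiAvg α (convFn (shift φ L f₁)) (convFn (shift φ L f₂)) x)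
          (((1 / L : ℝ) : EReal) * φ x)))) ∧
    (lbar = ⊤ →
      (∀ x, Tendsto (fun l : ℝ => proxAvg φ f₁ f₂ α l x) atTop
        (𝓝 (epiAvg α (convFn (fun z => f₁ z + indic (effDom φ) z))
          (convFn (fun z => f₂ z + indic (effDom φ) z)) x))) ∧
      EpiTendsto (fun l : ℝ => proxAvg φ f₁ f₂ α l) atTop
        (clFn (epiAvg α (convFn (fun z => f₁ z + indic (effDom φ) z))
          (convFn (fun z => f₂ z + indic (effDom φ) z))))) ∧
    (∀ x ∈ intDom φ, Tendsto (fun l : ℝ => proxAvg φ f₁ f₂ α l x) (𝓝[>] 0)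
      (𝓝 (arithAvg α f₁ f₂ x))) ∧
    (effDom f₁ ⊆ intDom φ → effDom f₂ ⊆ intDom φ →
      EpiTendsto (fun l : ℝ => proxAvg φ f₁ f₂ α l) (𝓝[>] 0) (arithAvg α f₁ f₂)) := by
  have hΓ := hφ.legendre.gammaZero
  have hrep : ∀ {l : ℝ}, 0 < l → (l : EReal) < lbar → ∀ x,
      proxAvg φ f₁ f₂ α l x = tiltedAvg φ f₁ f₂ α (1 / l) x := fun hl hlt x =>
    proxAvg_eq_tiltedAvg hφ hf₁ hf₂ hf₁_lsc hf₂_lsc hf₁_dom hf₂_dom hα hl (hlbar ▸ hlt) x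
  have hpos : 0 < lbar := by rw [hlbar]; exact lt_min hf₁_pb hf₂_pb
  have hsmall : ∀ᶠ l : ℝ in 𝓝[>] 0, 0 < l ∧ (l : EReal) < lbar := by
    obtain ⟨b, hb, hb'⟩ := EReal.lt_iff_exists_real_btwn.mp hpos
    filter_upwards [Ioo_mem_nhdsGT (show (0 : ℝ) < b by exact_mod_cast hb)] with l hl
    exact ⟨hl.1, (EReal.coe_lt_coe_iff.mpr hl.2).trans hb'⟩
  have hanti : ∀ x, AntitoneOn (fun l : ℝ => proxAvg φ f₁ f₂ α l x)
      {l : ℝ | 0 < l ∧ (l : EReal) < lbar} := by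
    intro x l hl l' hl' hll'
    simp only [hrep hl.1 hl.2, hrep hl'.1 hl'.2]
    exact tiltedAvg_mono hΓ hα x (one_div_le_one_div_of_le hl.1 hll')
  have hzero : ∀ x ∈ intDom φ, Tendsto (fun l : ℝ => proxAvg φ f₁ f₂ α l x) (𝓝[>] 0)
      (𝓝 (arithAvg α f₁ f₂ x)) := by
    intro x hx
    refine tendsto_order.mpr ⟨fun c hc => ?_, fun c hc => ?_⟩
    · obtain ⟨c', hcc', hc'⟩ := EReal.lt_iff_exists_real_btwn.mp hc
      obtain ⟨a, b, ha, hb, hab⟩ := exists_real_of_lt_wsum hα.1 (sub_nonneg.mpr hα.2) (hf₁.1 x)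
        (hf₂.1 x) hc'
      filter_upwards [self_mem_nhdsWithin, eventually_le_breg hφ hf₁_lsc hf₁_pb hx ha,
        eventually_le_breg hφ hf₂_lsc hf₂_pb hx hb] with l hl h1 h2
      exact (hcc'.trans (EReal.coe_lt_coe_iff.mpr hab)).trans_le
        (le_proxAvg hφ hf₁ hf₂ hα hl hx h1 h2)
    · filter_upwards [hsmall] with l hl
      rw [hrep hl.1 hl.2]
      exact (tiltedAvg_le_arithAvg hΓ.proper hf₁ hf₂ hf₁_dom hf₂_dom hα (intDom_subset hx)
        _).trans_lt hc
  refine ⟨hanti, fun L hL x => ?_, fun htop => ?_, hzero, fun h₁ h₂ l hl x => ?_⟩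
  · have hL0 : 0 < L := by rw [← hL] at hpos; exact_mod_cast hpos
    rw [upSub_epiAvg_shift hΓ hf₁ hf₂ hf₁_dom hf₂_dom hα hL0]
    have hev : ∀ᶠ l : ℝ in 𝓝[<] L, 0 < l ∧ l < L := Ioo_mem_nhdsLT hL0
    -- As l increases to L, 1/l decreases to 1/L, so right-continuity in t is exactly what is
    -- needed.
    have hinv : Tendsto (fun l : ℝ => 1 / l) (𝓝[<] L) (𝓝[≥] (1 / L)) := by
      refine tendsto_nhdsWithin_iff.mpr ⟨?_, hev.mono fun l hl =>
        one_div_le_one_div_of_le hl.1 hl.2.le⟩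
      exact ((continuousAt_const.div continuousAt_id hL0.ne').tendsto).mono_left nhdsWithin_le_nhds
    refine ((tiltedAvg_tendsto hΓ hα x (1 / L)).comp hinv).congr' ?_
    filter_upwards [hev] with l hl
    exact (hrep hl.1 (hL ▸ EReal.coe_lt_coe_iff.mpr hl.2) x).symm
  · have hrep' : ∀ᶠ l : ℝ in atTop, ∀ x,
        tiltedAvg φ f₁ f₂ α (1 / l) x = proxAvg φ f₁ f₂ α l x := by
      filter_upwards [eventually_gt_atTop 0] with l hl x
      exact (hrep hl (htop ▸ EReal.coe_lt_top l) x).symm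
    have hinv : Tendsto (fun l : ℝ => 1 / l) atTop (𝓝[≥] 0) := by
      simp only [one_div]
      exact tendsto_inv_atTop_nhdsGT_zero.mono_right (nhdsWithin_mono _ Set.Ioi_subset_Ici_self)
    have hpt : ∀ x, Tendsto (fun l : ℝ => proxAvg φ f₁ f₂ α l x) atTop
        (𝓝 (epiAvg α (convFn (fun z => f₁ z + indic (effDom φ) z))
          (convFn (fun z => f₂ z + indic (effDom φ) z)) x)) := by
      intro x
      rw [epiAvg_add_indic hΓ hf₁ hf₂ hf₁_dom hf₂_dom hα]
      exact ((tiltedAvg_tendsto hΓ hα x 0).comp hinv).congr' (hrep'.mono fun l hl => hl x)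
    refine ⟨hpt, fun l hl x => epiConvergesAt_clFn ?_ fun z => (hpt z).comp hl⟩
    filter_upwards [hl.eventually hrep', hl.eventually (eventually_gt_atTop 0)] with k hk hk0 z
    rw [epiAvg_add_indic hΓ hf₁ hf₂ hf₁_dom hf₂_dom hα, ← hk]
    exact tiltedAvg_mono hΓ hα z (one_div_pos.mpr hk0).le
  · have hoff : ∀ {μ : ℝ}, 0 < μ → (μ : EReal) < lbar → ∀ {x}, x ∉ intDom φ →
        proxAvg φ f₁ f₂ α μ x = ⊤ := fun hμ hμ' x hx => by
      rw [hrep hμ hμ', tiltedAvg_eq_top_of_subset hφ hα h₁ h₂ hx]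
    refine ⟨fun u hu => le_of_forall_lt_imp_le_of_dense fun c hc => ?_, fun _ => x, tendsto_const_nhds, ?_⟩
    -- Freeze a parameter μ whose average exceeds c at x. Lower semicontinuity spreads this bound to
    -- nearby points, and monotonicity passes it to all smaller parameters.
    · obtain ⟨μ, ⟨hμ, hμ'⟩, hcμ⟩ : ∃ μ : ℝ, (0 < μ ∧ (μ : EReal) < lbar) ∧
          c < proxAvg φ f₁ f₂ α μ x := by
        by_cases hx : x ∈ intDom φ
        · exact (hsmall.and ((hzero x hx).eventually (lt_mem_nhds hc))).exists
        · obtain ⟨μ, hμ⟩ := hsmall.exists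
          exact ⟨μ, hμ, by rw [hoff hμ.1 hμ.2 hx]; exact hc.trans_le le_top⟩
      have hlsc : LowerSemicontinuous fun z => proxAvg φ f₁ f₂ α μ z :=
        lowerSemicontinuous_upSub hφ (lowerSemicontinuous_conj _) (one_div_pos.mpr hμ)
          fun z hz => hoff hμ hμ' fun h => hz (intDom_subset h)
      refine le_liminf_of_le (by isBoundedDefault) ?_
      filter_upwards [hu.eventually (hlsc x c hcμ), hl.eventually hsmall,
        hl.eventually (nhdsWithin_le_nhds (eventually_le_nhds hμ))] with k hk hk' hkμ
      exact hk.le.trans (hanti _ hk' ⟨hμ, hμ'⟩ hkμ)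
    · by_cases hx : x ∈ intDom φ
      · exact (hzero x hx).comp hl
      · rw [arithAvg_eq_top hα (not_lt_top_iff.mp fun h => hx (h₁ h))
          (not_lt_top_iff.mp fun h => hx (h₂ h))]
        refine tendsto_const_nhds.congr' ?_
        filter_upwards [hl.eventually hsmall] with k hk
        exact (hoff hk.1 hk.2 hx).symm
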